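/- Let $\mathcal A$ be a Boolean algebra with Stone space $K_{\mathcal A}$, and suppose that $\mathcal A$ is an almost $P$-algebra, i.e. every nonempty $G_\delta$ subset of $K_{\mathcal A}$ has nonempty interior. Call a map $\phi$ between Boolean algebras a submorphism if $\phi(x\wedge y)=\phi(x)\wedge\phi(y)$, $\phi(x\vee y)=\phi(x)\vee\phi(y)$ and $\phi(0)=0$ (it need not preserve $1$). Call $I,J\subseteq\mathcal A$ orthogonal if $x\wedge y=0$ for all $x\in I$, $y\in J$, and separated in $\mathcal A$ if there is $c\in\mathcal A$ with $x\le c$ and $y\wedge c=0$ for all $x\in I$, $y\in J$. Suppose that for every sequence $a=(a_n)_{n<\omega}$ of pairwise disjoint nonzero elements of $\mathcal A$ there is a submorphism $\phi_a:\mathcal P_a\to\mathcal A$ such that 1. $\mathcal P_a$ is a Boolean subalgebra of $\mathcal P(\omega)$ that contains all finite sets; 2. $\phi_a(\{n\})=a_n$ for every $n<\omega$; 3. for every infinite $\sigma\subseteq\omega$ and every family $\{b_n:n\in\sigma\}$ of pairwise disjoint nonzero elements of $\mathcal A$ that is orthogonal to $\{a_n:n<\omega\}$, there is $\tau\subseteq\sigma$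 with $\tau\in\mathcal P_a$ such that $\{b_n:n\in\tau\}$ and $\{b_n:n\in\sigma\setminus\tau\}$ are not separated in $\mathcal A$. Then every bounded linear operator $T:C(K_{\mathcal A})\to C(K_{\mathcal A})$ on the Banach space of real-valued continuous functions is a weak multiplier: there are a bounded Borel function $g:K_{\mathcal A}\to\mathbb R$ and a weakly compact operator $S:M(K_{\mathcal A})\to M(K_{\mathcal A})$ on the dual space $M(K_{\mathcal A})=C(K_{\mathcal A})^*$ of regular signed Borel measures such that, for every $\mu\in M(K_{\mathcal A})$ and $f\in C(K_{\mathcal A})$, $$(T^*\mu)(f)=\int f g\,d\mu+(S\mu)(f).$$ -/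

import Mathlib

open MeasureTheory Set

/-- A topological space is an almost `P`-space if every nonempty `G_δ` subset of it has nonempty
interior. -/
def IsAlmostPSpace (X : Type*) [TopologicalSpace X] : Prop :=
  ∀ s : Set X, IsGδ s → s.Nonempty → (interior s).Nonempty

/-! ### The Stone space of a Boolean algebra -/

noncomputable section

/-- The Stone space of a Boolean algebra `A`: its points are the Boolean homomorphisms from `A` to
the two-element algebra (that is, the ultrafilters of `A`). -/
def StoneSpace (A : Type*) [BooleanAlgebra A] : Type _ := BoundedLatticeHom A Bool

namespace StoneSpace

variable {A : Type*} [BooleanAlgebra A]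

/-- A point of the Stone space as a `Bool`-valued function on the algebra. -/
def toFun (x : StoneSpace A) : A → Bool := (show BoundedLatticeHom A Bool from x)

/-- The topology of pointwise convergence. The sets `{x | x.toFun a = true}` with `a : A` form a
base of it that consists of clopen sets. -/
instance : TopologicalSpace (StoneSpace A) :=
  TopologicalSpace.induced toFun inferInstance

instance : MeasurableSpace (StoneSpace A) := borel _

instance : BorelSpace (StoneSpace A) := ⟨rfl⟩

theorem toFun_injective : Function.Injective (toFun : StoneSpace A → A → Bool) :=
  fun _ _ h => DFunLike.coe_injective (F := BoundedLatticeHom A Bool) h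

theorem isClosedEmbedding_toFun :
    Topology.IsClosedEmbedding (toFun : StoneSpace A → A → Bool) := by
  refine ⟨⟨⟨rfl⟩, toFun_injective⟩, ?_⟩
  have h : Set.range (toFun : StoneSpace A → A → Bool) =
      {f | f ⊤ = ⊤} ∩ {f | f ⊥ = ⊥} ∩ (⋂ a, ⋂ b, {f | f (a ⊔ b) = f a ⊔ f b}) ∩
        (⋂ a, ⋂ b, {f | f (a ⊓ b) = f a ⊓ f b}) := by
    ext f
    constructor
    · rintro ⟨x, rfl⟩
      refine ⟨⟨⟨?_, ?_⟩, ?_⟩, ?_⟩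
      · exact map_top (show BoundedLatticeHom A Bool from x)
      · exact map_bot (show BoundedLatticeHom A Bool from x)
      · exact mem_iInter₂.2 fun a b => map_sup (show BoundedLatticeHom A Bool from x) a b
      · exact mem_iInter₂.2 fun a b => map_inf (show BoundedLatticeHom A Bool from x) a b
    · rintro ⟨⟨⟨h1, h2⟩, h3⟩, h4⟩
      rw [mem_iInter₂] at h3 h4
      exact ⟨(⟨⟨⟨f, h3⟩, h4⟩, h1, h2⟩ : BoundedLatticeHom A Bool), rfl⟩
  rw [h]
  refine ((IsClosed.inter ?_ ?_).inter ?_).inter ?_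
  · exact isClosed_eq (continuous_apply _) continuous_const
  · exact isClosed_eq (continuous_apply _) continuous_const
  · refine isClosed_iInter fun a => isClosed_iInter fun b =>
      isClosed_eq (continuous_apply _) ?_
    have hc : Continuous fun p : Bool × Bool => p.1 ⊔ p.2 := continuous_of_discreteTopology
    exact hc.comp ((continuous_apply (A := fun _ : A => Bool) a).prodMk
      (continuous_apply (A := fun _ : A => Bool) b))
  · refine isClosed_iInter fun a => isClosed_iInter fun b =>
      isClosed_eq (continuous_apply _) ?_
    have hc : Continuous fun p : Bool × Bool => p.1 ⊓ p.2 := continuous_of_discreteTopology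
    exact hc.comp ((continuous_apply (A := fun _ : A => Bool) a).prodMk
      (continuous_apply (A := fun _ : A => Bool) b))

instance : CompactSpace (StoneSpace A) := isClosedEmbedding_toFun.compactSpace

instance : T2Space (StoneSpace A) := isClosedEmbedding_toFun.isEmbedding.t2Space

end StoneSpace

end

/-- A Boolean algebra is an almost `P`-algebra if its Stone space is an almost `P`-space. -/
def IsAlmostPAlgebra (A : Type*) [BooleanAlgebra A] : Prop := IsAlmostPSpace (StoneSpace A)

/-! ### Orthogonality, separation and submorphisms -/

/-- Two subsets of a Boolean algebra are orthogonal if `x ⊓ y = ⊥` for all `x ∈ I`, `y ∈ J`. -/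
def AreOrthogonal {A : Type*} [BooleanAlgebra A] (I J : Set A) : Prop :=
  ∀ x ∈ I, ∀ y ∈ J, x ⊓ y = ⊥

/-- Two subsets of a Boolean algebra are separated in it if some element `c` of the algebra is above
every element of the first and disjoint from every element of the second. -/
def AreSeparated {A : Type*} [BooleanAlgebra A] (I J : Set A) : Prop :=
  ∃ c : A, (∀ x ∈ I, x ≤ c) ∧ ∀ y ∈ J, y ⊓ c = ⊥

/-- A submorphism between Boolean algebras preserves binary meets, binary joins and the least
element, but not necessarily the greatest one. -/
structure IsSubmorphism {A B : Type*} [BooleanAlgebra A] [BooleanAlgebra B] (φ : A → B) :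
    Prop where
  map_inf : ∀ x y, φ (x ⊓ y) = φ x ⊓ φ y
  map_sup : ∀ x y, φ (x ⊔ y) = φ x ⊔ φ y
  map_bot : φ ⊥ = ⊥

/-! ### Operators on spaces of continuous functions -/

/-- A bounded operator is weakly compact if it maps the closed unit ball to a set whose closure in
the weak topology is weakly compact. -/
def IsWeaklyCompactOperator {E F : Type*} [NormedAddCommGroup E] [NormedSpace ℝ E]
    [NormedAddCommGroup F] [NormedSpace ℝ F] (S : E →L[ℝ] F) : Prop :=
  IsCompact (closure ((fun x => toWeakSpace ℝ F (S x)) '' Metric.closedBall (0 : E) 1))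

noncomputable section

/-- The adjoint `T* : Λ ↦ Λ ∘ T` of a bounded operator, acting between the dual spaces. -/
def dualOperator {E F : Type*} [NormedAddCommGroup E] [NormedSpace ℝ E]
    [NormedAddCommGroup F] [NormedSpace ℝ F] (T : E →L[ℝ] F) :
    StrongDual ℝ F →L[ℝ] StrongDual ℝ E :=
  (ContinuousLinearMap.compL ℝ E F ℝ).flip T

/-- The integral of a bounded measurable real function against a signed measure `μ`, through the
Jordan decomposition of `μ`. -/
def signedIntegral {K : Type*} [MeasurableSpace K] (μ : SignedMeasure K) (f : K → ℝ) : ℝ :=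
  ∫ x, f x ∂μ.toJordanDecomposition.posPart - ∫ x, f x ∂μ.toJordanDecomposition.negPart

variable {K : Type*} [TopologicalSpace K] [CompactSpace K] [MeasurableSpace K] [BorelSpace K]

theorem integrable_continuousMap (ν : Measure K) [IsFiniteMeasure ν] (f : C(K, ℝ)) :
    Integrable f ν :=
  Integrable.of_bound f.continuous.measurable.aestronglyMeasurable ‖f‖
    (Filter.Eventually.of_forall f.norm_coe_le_norm)

/-- The bounded functional `f ↦ ∫ f dν` on `C(K)` given by a finite positive Borel measure. -/
def integralFunctional (ν : Measure K) [IsFiniteMeasure ν] : StrongDual ℝ C(K, ℝ) :=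
  LinearMap.mkContinuous
    { toFun := fun f => ∫ x, f x ∂ν
      map_add' := fun f g => integral_add (integrable_continuousMap ν f)
        (integrable_continuousMap ν g)
      map_smul' := fun c f => integral_const_mul c f }
    (ν.real univ) (fun f => by
      have h := norm_integral_le_of_norm_le_const (μ := ν) (f := f) (C := ‖f‖)
        (Filter.Eventually.of_forall f.norm_coe_le_norm)
      rw [mul_comm]
      exact h)

/-- The bounded functional `f ↦ ∫ f dμ` on `C(K)` given by a signed Borel measure `μ`. When `μ`
ranges over the signed measures with regular total variation, and `K` is compact and Hausdorff, this
is the Riesz identification of `M(K)` with the dual of `C(K)`. -/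
def signedFunctional (μ : SignedMeasure K) : StrongDual ℝ C(K, ℝ) :=
  integralFunctional μ.toJordanDecomposition.posPart -
    integralFunctional μ.toJordanDecomposition.negPart

theorem signedFunctional_apply (μ : SignedMeasure K) (f : C(K, ℝ)) :
    signedFunctional μ f = signedIntegral μ f := rfl

/-- A bounded operator `T` on `C(K)` is a weak multiplier if there are a bounded Borel function
`g : K → ℝ` and a weakly compact operator `S` on the dual `M(K)` of `C(K)` such that
`T* μ = g μ + S μ` for every (regular, signed) `μ` in `M(K)`. Both sides are functionals on `C(K)`,
and `g μ` is the functional `f ↦ ∫ f g dμ`. -/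
def IsWeakMultiplier (T : C(K, ℝ) →L[ℝ] C(K, ℝ)) : Prop :=
  ∃ g : K → ℝ, Measurable g ∧ (∃ C : ℝ, ∀ x, |g x| ≤ C) ∧
    ∃ S : StrongDual ℝ C(K, ℝ) →L[ℝ] StrongDual ℝ C(K, ℝ),
      IsWeaklyCompactOperator (E := StrongDual ℝ C(K, ℝ)) (F := StrongDual ℝ C(K, ℝ)) S ∧
      ∀ μ : SignedMeasure K, μ.totalVariation.Regular → ∀ f : C(K, ℝ),
        dualOperator T (signedFunctional μ) f =
          signedIntegral μ (fun x => f x * g x) + S (signedFunctional μ) f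

end

/-! Call `T` negligible off the support if `T 1_{b n} (y n)` cannot stay away from zero for disjoint
clopen `b n` and points `y n` outside `b n`. The theorem splits into two claims: the hypotheses
force this property, and this property makes `T` a weak multiplier.

For the second claim, `T 1_w (x)` converges as the clopen set `w` shrinks to `x`, and the limit `g
x` is the point mass at `x` of the measure `f ↦ T f x`. Negligibility leaves `g` only countably many
discontinuities, so `g` is Borel. It also makes `T* - g` uniformly small along disjoint clopen
sequences. Such uniform exhaustivity gives weak compactness: finitely many of the submeasures `a ↦
‖Λ|a‖` control all of them, so a single measure `ν` dominates the image of the ball in `L²(ν)` up to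
`ε`, and balls of Hilbert spaces are weakly compact.

For the first claim, take a violating sequence `a n`, `x n`. Rosenthal's lemma makes the values `T
1_{a m} (x n)`, `m ≠ n`, negligible in sum, and the almost `P` property makes all the `T 1_{a m}`
constant on an open set near each `x n`. For `τ` in the domain of the submorphism `φ`, `T 1_{φ τ}`
should be about `T 1_{a n} (x n)` there when `n ∈ τ` and about `0` otherwise. The error is the
contribution of `φ τ` beyond the `a n`. Over almost disjoint sets `τ` these errors add up to at most
`‖T‖`, so among uncountably many almost disjoint branches one has small errors for all its subsets
and all `n`. Level sets of `T 1_{φ τ}` then separate what condition 3 declares inseparable. -/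

set_option linter.unusedSectionVars false

/-! ### Functionals on `C(K)` and measures -/

section FunctionalsAndMeasures

variable {K : Type*} [TopologicalSpace K] [CompactSpace K]

/-- A functional on `C(K)` is a difference of two positive ones of no larger total norm. -/
theorem exists_positive_decomposition (Λ : StrongDual ℝ C(K, ℝ)) :
    ∃ P N : C(K, ℝ) →ₗ[ℝ] ℝ, (∀ f, 0 ≤ f → 0 ≤ P f) ∧ (∀ f, 0 ≤ f → 0 ≤ N f) ∧
      (∀ f, Λ f = P f - N f) ∧ P 1 + N 1 ≤ ‖Λ‖ := by
  -- The antidiagonal: `Λ` is placed on the pairs `(f, -f)`. A Hahn–Banach extension `Φ` then yields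
  -- `P f = Φ (f, 0)` and `N f = Φ (0, f)`.
  let D : Submodule ℝ (C(K, ℝ) × C(K, ℝ)) :=
    { carrier := {p | p.1 + p.2 = 0}
      add_mem' := by
        intro a b ha hb
        simp only [mem_ofPred_eq, Prod.fst_add, Prod.snd_add] at *
        rw [add_add_add_comm, ha, hb, add_zero]
      zero_mem' := by simp
      smul_mem' := by
        intro c a ha
        simp only [mem_ofPred_eq, Prod.smul_fst, Prod.smul_snd] at *
        rw [← smul_add, ha, smul_zero] }
  let L : (C(K, ℝ) × C(K, ℝ)) →ₗ.[ℝ] ℝ :=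
    ⟨D, ((Λ : C(K, ℝ) →ₗ[ℝ] ℝ) ∘ₗ LinearMap.fst ℝ _ _).domRestrict D⟩
  obtain ⟨Φ, hΦ, hle⟩ := exists_extension_of_le_sublinear L
    -- This bound sees only the positive parts. It vanishes at `(-f, 0)` and `(0, -f)` for `f ≥ 0`,
    -- which gives positivity, and its value at `(1, 1)` bounds the total mass.
    (fun p => ‖Λ‖ * ‖(p.1 ⊔ p.2) ⊔ 0‖) (by
      intro c hc p
      have : ((c • p).1 ⊔ (c • p).2) ⊔ 0 = c • ((p.1 ⊔ p.2) ⊔ 0) := by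
        ext x
        simp [mul_max_of_nonneg _ _ hc.le]
      rw [this, norm_smul, Real.norm_of_nonneg hc.le]
      ring) (by
      intro p q
      rw [← mul_add]
      refine mul_le_mul_of_nonneg_left ?_ (norm_nonneg Λ)
      rw [ContinuousMap.norm_le _ (by positivity)]
      intro x
      have h1 := ContinuousMap.norm_coe_le_norm ((p.1 ⊔ p.2) ⊔ 0) x
      have h2 := ContinuousMap.norm_coe_le_norm ((q.1 ⊔ q.2) ⊔ 0) x
      simp only [ContinuousMap.sup_apply, ContinuousMap.zero_apply, Prod.fst_add, Prod.snd_add,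
        ContinuousMap.add_apply, Real.norm_eq_abs] at *
      rw [abs_of_nonneg (le_max_right _ _)] at *
      refine max_le (max_le ?_ ?_) (by positivity)
      · exact add_le_add ((le_max_left _ _).trans ((le_max_left _ _).trans h1))
          ((le_max_left _ _).trans ((le_max_left _ _).trans h2))
      · exact add_le_add ((le_max_right _ _).trans ((le_max_left _ _).trans h1))
          ((le_max_right _ _).trans ((le_max_left _ _).trans h2))) (by
      rintro ⟨⟨f, h⟩, hfh⟩
      have hfh : f + h = 0 := hfh
      obtain rfl : h = -f := (neg_eq_of_add_eq_zero_right hfh).symm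
      change Λ f ≤ _
      refine (le_abs_self _).trans ((Λ.le_opNorm f).trans ?_)
      refine mul_le_mul_of_nonneg_left ?_ (norm_nonneg Λ)
      rw [ContinuousMap.norm_le _ (by positivity)]
      intro x
      refine le_trans ?_ (ContinuousMap.norm_coe_le_norm _ x)
      simp only [ContinuousMap.sup_apply, ContinuousMap.zero_apply, ContinuousMap.neg_apply,
        Real.norm_eq_abs]
      exact (le_max_left _ _).trans (le_abs_self _))
  refine ⟨Φ ∘ₗ LinearMap.inl ℝ _ _, Φ ∘ₗ LinearMap.inr ℝ _ _, ?_, ?_, ?_, ?_⟩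
  · intro f hf
    have h := hle (-f, 0)
    have h0 : ((-f : C(K, ℝ)) ⊔ 0) ⊔ 0 = 0 := by simpa using hf
    have h1 : Φ (-f, 0) = - Φ (f, 0) := by rw [← map_neg]; simp
    simp only [h0, h1, norm_zero, mul_zero] at h
    simpa using h
  · intro f hf
    have h := hle (0, -f)
    have h0 : ((0 : C(K, ℝ)) ⊔ (-f)) ⊔ 0 = 0 := by simpa using hf
    have h1 : Φ (0, -f) = - Φ (0, f) := by rw [← map_neg]; simp
    simp only [h0, h1, norm_zero, mul_zero] at h
    simpa using h
  · intro f
    have h := hΦ ⟨(f, -f), by change f + -f = 0; simp⟩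
    change Φ (f, -f) = Λ f at h
    rw [← h]
    simp only [LinearMap.comp_apply, LinearMap.inl_apply, LinearMap.inr_apply, ← map_sub]
    simp
  · simp only [LinearMap.comp_apply, LinearMap.inl_apply, LinearMap.inr_apply, ← map_add]
    refine (hle _).trans (mul_le_of_le_one_right (norm_nonneg Λ) ?_)
    rw [ContinuousMap.norm_le _ zero_le_one]
    intro x
    simp

variable [T2Space K] [MeasurableSpace K] [BorelSpace K]

theorem exists_measure_of_positive (P : C(K, ℝ) →ₗ[ℝ] ℝ) (hP : ∀ f, 0 ≤ f → 0 ≤ P f) :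
    ∃ μ : Measure K, IsFiniteMeasure μ ∧ μ.Regular ∧ ∀ f : C(K, ℝ), P f = ∫ x, f x ∂μ := by
  let Λ : CompactlySupportedContinuousMap K ℝ →ₚ[ℝ] ℝ :=
    { toFun := fun g => P g.toContinuousMap
      map_add' := fun g g' => map_add P g.toContinuousMap g'.toContinuousMap
      map_smul' := fun c g => map_smul P c g.toContinuousMap
      monotone' := fun g g' hgg' => by
        have h := hP (g'.toContinuousMap - g.toContinuousMap) (sub_nonneg.2 hgg')
        rw [map_sub] at h
        exact sub_nonneg.1 h }
  refine ⟨RealRMK.rieszMeasure Λ, inferInstance, inferInstance, fun f => ?_⟩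
  exact (RealRMK.integral_rieszMeasure Λ ⟨f, HasCompactSupport.of_compactSpace _⟩).symm

/-- The Riesz representation of a functional on `C(K)` by two finite regular measures. -/
theorem exists_measure_decomposition (Λ : StrongDual ℝ C(K, ℝ)) :
    ∃ P N : Measure K, IsFiniteMeasure P ∧ IsFiniteMeasure N ∧ P.Regular ∧ N.Regular ∧
      (∀ f : C(K, ℝ), Λ f = ∫ x, f x ∂P - ∫ x, f x ∂N) ∧
      P.real univ + N.real univ ≤ ‖Λ‖ := by
  obtain ⟨p, n, hp, hn, h, hnorm⟩ := exists_positive_decomposition Λ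
  obtain ⟨P, hP1, hP2, hP⟩ := exists_measure_of_positive p hp
  obtain ⟨N, hN1, hN2, hN⟩ := exists_measure_of_positive n hn
  refine ⟨P, N, hP1, hN1, hP2, hN2, fun f => by rw [h, hP, hN], ?_⟩
  simpa [hP, hN] using hnorm

/-- Moving the negative terms across gives `P + N' = P' + N` as regular measures, by uniqueness in
the Riesz theorem, so bounded Borel integrands cannot tell the two differences apart. -/
theorem integral_sub_integral_congr {P N P' N' : Measure K} [IsFiniteMeasure P]
    [IsFiniteMeasure N] [IsFiniteMeasure P'] [IsFiniteMeasure N'] [P.Regular] [N.Regular]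
    [P'.Regular] [N'.Regular]
    (h : ∀ f : C(K, ℝ), ∫ x, f x ∂P - ∫ x, f x ∂N = ∫ x, f x ∂P' - ∫ x, f x ∂N')
    {g : K → ℝ} (hg : Measurable g) {C : ℝ} (hC : ∀ x, |g x| ≤ C) :
    ∫ x, g x ∂P - ∫ x, g x ∂N = ∫ x, g x ∂P' - ∫ x, g x ∂N' := by
  have hint : ∀ (ν : Measure K) [IsFiniteMeasure ν], Integrable g ν := fun ν _ =>
    Integrable.of_bound hg.aestronglyMeasurable C (Filter.Eventually.of_forall hC)
  have hm : P + N' = P' + N := by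
    refine Measure.ext_of_integral_eq_on_compactlySupported fun f => ?_
    have hf := h f.toContinuousMap
    change ∫ x, f.toContinuousMap x ∂(P + N') = ∫ x, f.toContinuousMap x ∂(P' + N)
    rw [integral_add_measure (integrable_continuousMap P f.toContinuousMap)
      (integrable_continuousMap N' f.toContinuousMap),
      integral_add_measure (integrable_continuousMap P' f.toContinuousMap)
      (integrable_continuousMap N f.toContinuousMap)]
    linarith
  have h2 : ∫ x, g x ∂(P + N') = ∫ x, g x ∂(P' + N) := by rw [hm]
  rw [integral_add_measure (hint _) (hint _), integral_add_measure (hint _) (hint _)] at h2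
  linarith

noncomputable section

/-- The functional `f ↦ ∫ f g dΛ` for a bounded Borel function `g`, through some representation of
`Λ` by measures. -/
def integralMul (g : K → ℝ) (Λ : StrongDual ℝ C(K, ℝ)) (f : C(K, ℝ)) : ℝ :=
  ∫ x, f x * g x ∂(exists_measure_decomposition Λ).choose -
    ∫ x, f x * g x ∂(exists_measure_decomposition Λ).choose_spec.choose

theorem measurable_mul_bounded {g : K → ℝ} (hg : Measurable g) (f : C(K, ℝ)) :
    Measurable fun x => f x * g x := f.continuous.measurable.mul hg

theorem abs_mul_le_of_bounded {g : K → ℝ} {C : ℝ} (hC : ∀ x, |g x| ≤ C) (f : C(K, ℝ)) (x : K) :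
    |f x * g x| ≤ ‖f‖ * C := by
  rw [abs_mul]
  exact mul_le_mul (f.norm_coe_le_norm x) (hC x) (abs_nonneg _) (norm_nonneg _)

theorem integrable_mul_bounded {g : K → ℝ} (hg : Measurable g) {C : ℝ} (hC : ∀ x, |g x| ≤ C)
    (f : C(K, ℝ)) (ν : Measure K) [IsFiniteMeasure ν] : Integrable (fun x => f x * g x) ν :=
  Integrable.of_bound (measurable_mul_bounded hg f).aestronglyMeasurable _
    (Filter.Eventually.of_forall (abs_mul_le_of_bounded hC f))

/-- The value does not depend on the chosen representation, so linearity in `Λ` can be checked with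
convenient measures. -/
theorem integralMul_eq {g : K → ℝ} (hg : Measurable g) {C : ℝ} (hC : ∀ x, |g x| ≤ C)
    {Λ : StrongDual ℝ C(K, ℝ)} {P N : Measure K} [IsFiniteMeasure P] [IsFiniteMeasure N]
    [P.Regular] [N.Regular] (h : ∀ f : C(K, ℝ), Λ f = ∫ x, f x ∂P - ∫ x, f x ∂N)
    (f : C(K, ℝ)) : integralMul g Λ f = ∫ x, f x * g x ∂P - ∫ x, f x * g x ∂N := by
  obtain ⟨h1, h2, h3, h4, h5, -⟩ := (exists_measure_decomposition Λ).choose_spec.choose_spec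
  exact integral_sub_integral_congr (fun f => by rw [← h5, h]) (measurable_mul_bounded hg f)
    (abs_mul_le_of_bounded hC f)

theorem abs_integral_sub_integral_le {P N : Measure K} [IsFiniteMeasure P] [IsFiniteMeasure N]
    {g : K → ℝ} {C : ℝ} (hC : ∀ x, |g x| ≤ C) :
    |∫ x, g x ∂P - ∫ x, g x ∂N| ≤ C * (P.real univ + N.real univ) := by
  have h1 := norm_integral_le_of_norm_le_const (μ := P) (f := g) (Filter.Eventually.of_forall hC)
  have h2 := norm_integral_le_of_norm_le_const (μ := N) (f := g) (Filter.Eventually.of_forall hC)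
  rw [Real.norm_eq_abs] at h1 h2
  refine (abs_sub _ _).trans ?_
  linarith

/-- Multiplication by a bounded Borel function, as an operator on the dual of `C(K)`. -/
def mulDual (g : K → ℝ) (hg : Measurable g) (C : ℝ) (hC : ∀ x, |g x| ≤ C) :
    StrongDual ℝ C(K, ℝ) →L[ℝ] StrongDual ℝ C(K, ℝ) :=
  LinearMap.mkContinuous₂
    (LinearMap.mk₂ ℝ (fun Λ f => integralMul g Λ f)
      (by
        intro Λ Λ' f
        obtain ⟨P, N, _, _, _, _, h, -⟩ := exists_measure_decomposition Λ
        obtain ⟨P', N', _, _, _, _, h', -⟩ := exists_measure_decomposition Λ'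
        have hs : ∀ f : C(K, ℝ), (Λ + Λ') f = ∫ x, f x ∂(P + P') - ∫ x, f x ∂(N + N') := by
          intro f
          rw [integral_add_measure (integrable_continuousMap _ _) (integrable_continuousMap _ _),
            integral_add_measure (integrable_continuousMap _ _) (integrable_continuousMap _ _),
            _root_.add_apply, h, h']
          ring
        have hi := integrable_mul_bounded hg hC f
        rw [integralMul_eq hg hC hs, integralMul_eq hg hC h, integralMul_eq hg hC h',
          integral_add_measure (hi _) (hi _), integral_add_measure (hi _) (hi _)]
        ring)
      (by
        intro c Λ f
        obtain ⟨P, N, _, _, _, _, h, -⟩ := exists_measure_decomposition Λ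
        -- Measures scale only by nonnegative numbers; a negative scalar is handled by exchanging
        -- `P` and `N`.
        have key : ∀ c : NNReal, ∀ Λ : StrongDual ℝ C(K, ℝ), ∀ P N : Measure K,
            IsFiniteMeasure P → IsFiniteMeasure N → P.Regular → N.Regular →
            (∀ f : C(K, ℝ), Λ f = ∫ x, f x ∂P - ∫ x, f x ∂N) →
            integralMul g ((c : ℝ) • Λ) f = c * integralMul g Λ f := by
          intro c Λ P N _ _ _ _ h
          have hs : ∀ f : C(K, ℝ), ((c : ℝ) • Λ) f = ∫ x, f x ∂(c • P) - ∫ x, f x ∂(c • N) := by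
            intro f
            rw [integral_smul_nnreal_measure, integral_smul_nnreal_measure, NNReal.smul_def,
              NNReal.smul_def, _root_.smul_apply, h, smul_eq_mul, smul_eq_mul,
              smul_eq_mul, mul_sub]
          rw [integralMul_eq hg hC hs, integralMul_eq hg hC h, integral_smul_nnreal_measure,
            integral_smul_nnreal_measure, NNReal.smul_def, NNReal.smul_def, smul_eq_mul,
            smul_eq_mul, mul_sub]
        have hneg : ∀ f : C(K, ℝ), (-Λ) f = ∫ x, f x ∂N - ∫ x, f x ∂P := by
          intro f
          rw [_root_.neg_apply, h, neg_sub]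
        rcases le_total 0 c with hc | hc
        · exact key ⟨c, hc⟩ Λ P N ‹_› ‹_› ‹_› ‹_› h
        · have := key ⟨-c, neg_nonneg.2 hc⟩ (-Λ) N P ‹_› ‹_› ‹_› ‹_› hneg
          change integralMul g ((-c) • (-Λ)) f = -c * integralMul g (-Λ) f at this
          rw [neg_smul_neg] at this
          rw [this, integralMul_eq hg hC hneg, integralMul_eq hg hC h, smul_eq_mul]
          ring)
      (by
        intro Λ f f'
        obtain ⟨P, N, _, _, _, _, h, -⟩ := exists_measure_decomposition Λ
        have hi := integrable_mul_bounded hg hC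
        simp only [integralMul_eq hg hC h, ContinuousMap.add_apply, add_mul]
        rw [integral_add (hi _ _) (hi _ _), integral_add (hi _ _) (hi _ _)]
        ring)
      (by
        intro c Λ f
        obtain ⟨P, N, _, _, _, _, h, -⟩ := exists_measure_decomposition Λ
        simp only [integralMul_eq hg hC h, ContinuousMap.smul_apply, smul_eq_mul, mul_assoc,
          integral_const_mul]
        ring))
    -- On an empty space `C` may be negative.
    (C ⊔ 0)
    (by
      intro Λ f
      obtain ⟨P, N, _, _, _, _, h, hn⟩ := exists_measure_decomposition Λ
      rw [LinearMap.mk₂_apply, integralMul_eq hg hC h, Real.norm_eq_abs]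
      refine (abs_integral_sub_integral_le (abs_mul_le_of_bounded
        (fun x => (hC x).trans (le_max_left C 0)) f)).trans ?_
      calc ‖f‖ * (C ⊔ 0) * (P.real univ + N.real univ) ≤ ‖f‖ * (C ⊔ 0) * ‖Λ‖ := by gcongr
        _ = (C ⊔ 0) * ‖Λ‖ * ‖f‖ := by ring)

theorem mulDual_apply {g : K → ℝ} (hg : Measurable g) {C : ℝ} (hC : ∀ x, |g x| ≤ C)
    {Λ : StrongDual ℝ C(K, ℝ)} {P N : Measure K} [IsFiniteMeasure P] [IsFiniteMeasure N]
    [P.Regular] [N.Regular] (h : ∀ f : C(K, ℝ), Λ f = ∫ x, f x ∂P - ∫ x, f x ∂N)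
    (f : C(K, ℝ)) : mulDual g hg C hC Λ f = ∫ x, f x * g x ∂P - ∫ x, f x * g x ∂N :=
  integralMul_eq hg hC h f

/-- Each Jordan part is the total variation restricted to one side of a Hahn decomposition, and
restriction keeps regularity of finite measures. -/
theorem regular_posPart_negPart {μ : SignedMeasure K} (h : μ.totalVariation.Regular) :
    μ.toJordanDecomposition.posPart.Regular ∧ μ.toJordanDecomposition.negPart.Regular := by
  obtain ⟨s, hs, hp, hn⟩ := μ.toJordanDecomposition.mutuallySingular
  have h1 : μ.toJordanDecomposition.posPart = μ.totalVariation.restrict sᶜ := by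
    rw [SignedMeasure.totalVariation, Measure.restrict_add, Measure.restrict_eq_zero.2 hn,
      add_zero]
    refine (Measure.restrict_eq_self_of_ae_mem ?_).symm
    rw [ae_iff]
    simpa using hp
  have h2 : μ.toJordanDecomposition.negPart = μ.totalVariation.restrict s := by
    rw [SignedMeasure.totalVariation, Measure.restrict_add, Measure.restrict_eq_zero.2 hp,
      zero_add]
    refine (Measure.restrict_eq_self_of_ae_mem ?_).symm
    rw [ae_iff]
    exact hn
  rw [h1, h2]
  exact ⟨Measure.Regular.restrict_of_measure_ne_top (measure_ne_top _ _),
    Measure.Regular.restrict_of_measure_ne_top (measure_ne_top _ _)⟩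

theorem mulDual_signedFunctional {g : K → ℝ} (hg : Measurable g) {C : ℝ} (hC : ∀ x, |g x| ≤ C)
    {μ : SignedMeasure K} (h : μ.totalVariation.Regular) (f : C(K, ℝ)) :
    mulDual g hg C hC (signedFunctional μ) f = signedIntegral μ fun x => f x * g x := by
  obtain ⟨h1, h2⟩ := regular_posPart_negPart h
  exact mulDual_apply hg hC (fun f => signedFunctional_apply μ f) f

end

end FunctionalsAndMeasures

/-! ### A criterion for weak compactness in dual spaces -/

section WeakCompactness

universe u

variable {E : Type u} [NormedAddCommGroup E] [NormedSpace ℝ E]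

/-- A functional dominated by `‖j f‖ + ε ‖f‖` is a sum of a contractive functional composed with
`j` and of a functional of norm at most `ε`. -/
theorem exists_comp_add_of_le {H : Type*} [NormedAddCommGroup H] [NormedSpace ℝ H]
    (j : E →L[ℝ] H) {ε : ℝ} (hε : 0 ≤ ε) (Λ : StrongDual ℝ E)
    (hΛ : ∀ f, |Λ f| ≤ ‖j f‖ + ε * ‖f‖) :
    ∃ h : StrongDual ℝ H, ‖h‖ ≤ 1 ∧ ‖Λ - h.comp j‖ ≤ ε := by
  -- The graph of `j`: `Λ` extends from it to `H × E` below `‖v‖ + ε ‖f‖`, and the two coordinates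
  -- of the extension are the two summands.
  let D : Submodule ℝ (H × E) :=
    { carrier := {p | p.1 = j p.2}
      add_mem' := by
        intro a b ha hb
        simp only [mem_ofPred_eq, Prod.fst_add, Prod.snd_add, map_add] at *
        rw [ha, hb]
      zero_mem' := by simp
      smul_mem' := by
        intro c a ha
        simp only [mem_ofPred_eq, Prod.smul_fst, Prod.smul_snd, map_smul] at *
        rw [ha] }
  let L : (H × E) →ₗ.[ℝ] ℝ :=
    ⟨D, ((Λ : E →ₗ[ℝ] ℝ) ∘ₗ LinearMap.snd ℝ _ _).domRestrict D⟩
  obtain ⟨Φ, hΦ, hle⟩ := exists_extension_of_le_sublinear L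
    (fun p => ‖p.1‖ + ε * ‖p.2‖) (by
      intro c hc p
      simp only [Prod.smul_fst, Prod.smul_snd, norm_smul, Real.norm_of_nonneg hc.le]
      ring) (by
      intro p q
      have h1 := norm_add_le p.1 q.1
      have h2 := mul_le_mul_of_nonneg_left (norm_add_le p.2 q.2) hε
      simp only [Prod.fst_add, Prod.snd_add]
      linarith) (by
      rintro ⟨⟨v, f⟩, hvf⟩
      have hvf : v = j f := hvf
      change Λ f ≤ ‖v‖ + ε * ‖f‖
      rw [hvf]
      exact (le_abs_self _).trans (hΛ f))
  have habs : ∀ p, |Φ p| ≤ ‖p.1‖ + ε * ‖p.2‖ := by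
    intro p
    refine abs_le.2 ⟨?_, hle p⟩
    have := hle (-p)
    simp only [map_neg, Prod.fst_neg, Prod.snd_neg, norm_neg] at this
    linarith
  refine ⟨LinearMap.mkContinuous (Φ ∘ₗ LinearMap.inl ℝ _ _) 1 (fun v => ?_),
    LinearMap.mkContinuous_norm_le _ zero_le_one _, ?_⟩
  · simpa using habs (v, 0)
  · refine ContinuousLinearMap.opNorm_le_bound _ hε fun f => ?_
    have h1 : Φ (j f, f) = Λ f := hΦ ⟨(j f, f), rfl⟩
    have h2 : (Λ - (LinearMap.mkContinuous (Φ ∘ₗ LinearMap.inl ℝ _ _) 1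
        (fun v => by simpa using habs (v, 0))).comp j) f = Φ (0, f) := by
      change Λ f - Φ (j f, 0) = Φ (0, f)
      rw [← h1, ← map_sub]
      simp
    rw [h2]
    simpa using habs (0, f)

/-- Reflexivity of Hilbert spaces, from the Riesz isomorphism used for `H` and its dual. -/
theorem exists_eval_of_hilbert {H : Type*} [NormedAddCommGroup H] [InnerProductSpace ℝ H]
    [CompleteSpace H] (F : StrongDual ℝ (StrongDual ℝ H)) : ∃ v : H, ∀ h, F h = h v := by
  let G : StrongDual ℝ H :=
    LinearMap.mkContinuous
      { toFun := fun v => F (InnerProductSpace.toDual ℝ H v)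
        map_add' := fun v w => by rw [map_add, map_add]
        map_smul' := fun c v => by rw [map_smulₛₗ, map_smulₛₗ]; rfl } ‖F‖ (fun v => by
      rw [← (InnerProductSpace.toDual ℝ H).norm_map v]
      exact F.le_opNorm _)
  refine ⟨(InnerProductSpace.toDual ℝ H).symm G, fun h => ?_⟩
  obtain ⟨w, rfl⟩ := (InnerProductSpace.toDual ℝ H).surjective h
  rw [InnerProductSpace.toDual_apply_apply, real_inner_comm,
    InnerProductSpace.toDual_symm_apply]
  rfl

theorem mem_range_of_forall_norm_sub_lt {X Y : Type*} [SeminormedAddCommGroup X]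
    [CompleteSpace X] [SeminormedAddCommGroup Y] [T2Space Y] {J : X → Y}
    (hJ : ∀ x x', ‖J x - J x'‖ = ‖x - x'‖) {y : Y}
    (h : ∀ ε : ℝ, 0 < ε → ∃ x, ‖y - J x‖ < ε) : y ∈ range J := by
  have hJ' : Isometry J := Isometry.of_dist_eq fun x x' => by
    rw [dist_eq_norm, dist_eq_norm, hJ]
  have hcl : IsClosed (range J) := hJ'.isUniformInducing.isComplete_range.isClosed
  rw [← hcl.closure_eq, Metric.mem_closure_iff]
  intro ε hε
  obtain ⟨x, hx⟩ := h ε hε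
  exact ⟨J x, mem_range_self x, by rwa [dist_eq_norm]⟩

open scoped Pointwise in
/-- A bounded set that is contained, up to small errors, in images of balls of Hilbert spaces is
relatively weakly compact. -/
theorem isCompact_closure_toWeakSpace_of_hilbert_approx {X : Type u} [NormedAddCommGroup X]
    [NormedSpace ℝ X] [CompleteSpace X] {W : Set X} (hb : Bornology.IsBounded W)
    (hW : ∀ ε : ℝ, 0 < ε → ∃ (H : Type u) (_ : NormedAddCommGroup H) (_ : InnerProductSpace ℝ H)
      (_ : CompleteSpace H) (k : StrongDual ℝ H →L[ℝ] X),
      ∀ x ∈ W, ∃ h, ‖h‖ ≤ 1 ∧ ‖x - k h‖ ≤ ε) :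
    IsCompact (closure (toWeakSpace ℝ X '' W)) := by
  refine NormedSpace.isCompact_closure_of_isBounded ℝ X _ ?_ ?_
  · rwa [preimage_image_eq _ (toWeakSpace ℝ X).injective]
  intro ξ hξ
  let J := NormedSpace.inclusionInDoubleDual ℝ X
  have hJ : ∀ x, ‖J x‖ = ‖x‖ := (NormedSpace.inclusionInDoubleDualLi ℝ (E := X)).norm_map
  -- Relative weak compactness of a bounded set means that its weak* closure in the bidual stays
  -- inside `X`; it suffices to approximate `ξ` in norm by elements of `X`.
  suffices h : WeakDual.toStrongDual ξ ∈ range J by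
    obtain ⟨x, hx⟩ := h
    exact ⟨toWeakSpace ℝ _ x, hx⟩
  refine mem_range_of_forall_norm_sub_lt
    (fun x x' => by rw [← map_sub, hJ]) fun ε hε => ?_
  obtain ⟨H, _, _, _, k, hk⟩ := hW (ε / 2) (half_pos hε)
  let κ : WeakDual ℝ H → WeakDual ℝ (StrongDual ℝ X) :=
    fun h => StrongDual.toWeakDual (J (k (WeakDual.toStrongDual h)))
  -- Reflexivity of `H` turns each `F ∘ k` into evaluation at a vector, so `κ` is weak*-to-weak*
  -- continuous and sends the ball to a compact set.
  have hκ : Continuous κ := by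
    refine WeakBilin.continuous_of_continuous_eval _ fun F => ?_
    obtain ⟨v, hv⟩ := exists_eval_of_hilbert (F.comp k)
    have : (fun h : WeakDual ℝ H => F (k (WeakDual.toStrongDual h))) = fun h => h v :=
      funext fun h => hv (WeakDual.toStrongDual h)
    change Continuous fun h : WeakDual ℝ H => F (k (WeakDual.toStrongDual h))
    rw [this]
    exact WeakDual.eval_continuous v
  have hD1 := (WeakDual.isCompact_closedBall (𝕜 := ℝ) (E := H) 0 1).image hκ
  have hD2 := WeakDual.isCompact_closedBall (𝕜 := ℝ) (0 : StrongDual ℝ (StrongDual ℝ X)) (ε / 2)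
  have hD := (hD1.add hD2).isClosed
  have hmem : ξ ∈ _ := closure_minimal (by
    rintro _ ⟨_, ⟨x, hx, rfl⟩, rfl⟩
    obtain ⟨h, h1, h2⟩ := hk x hx
    refine ⟨κ (StrongDual.toWeakDual h), ⟨_, by simpa using h1, rfl⟩,
      StrongDual.toWeakDual (J (x - k h)), ?_, ?_⟩
    · exact mem_closedBall_zero_iff.2 ((hJ _).trans_le h2)
    · change J (k h) + J (x - k h) = J x
      rw [← map_add, add_sub_cancel]) hD hξ
  obtain ⟨_, ⟨h, -, rfl⟩, ρ, hρ, rfl⟩ := hmem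
  refine ⟨k (WeakDual.toStrongDual h), ?_⟩
  have hρ : ‖WeakDual.toStrongDual ρ‖ ≤ ε / 2 := by simpa using hρ
  have heq : WeakDual.toStrongDual (κ h + ρ) =
      J (k (WeakDual.toStrongDual h)) + WeakDual.toStrongDual ρ := rfl
  change ‖WeakDual.toStrongDual (κ h + ρ) - _‖ < ε
  rw [heq]
  calc _ = ‖WeakDual.toStrongDual ρ‖ :=
        congrArg norm (add_sub_cancel_left (J (k (WeakDual.toStrongDual h))) _)
    _ < ε := by linarith

/-- A bounded set of functionals that are dominated, up to small multiples of the norm, by Hilbert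
space seminorms, is relatively weakly compact. -/
theorem isCompact_closure_toWeakSpace_of_hilbert_bound {W : Set (StrongDual ℝ E)}
    (hb : Bornology.IsBounded W)
    (hW : ∀ ε : ℝ, 0 < ε → ∃ (H : Type u) (_ : NormedAddCommGroup H) (_ : InnerProductSpace ℝ H)
      (_ : CompleteSpace H) (j : E →L[ℝ] H), ∀ Λ ∈ W, ∀ f, |Λ f| ≤ ‖j f‖ + ε * ‖f‖) :
    IsCompact (closure (toWeakSpace ℝ (StrongDual ℝ E) '' W)) := by
  refine isCompact_closure_toWeakSpace_of_hilbert_approx hb fun ε hε => ?_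
  obtain ⟨H, _, _, _, j, hj⟩ := hW ε hε
  exact ⟨H, _, _, ‹_›, (ContinuousLinearMap.compL ℝ E H ℝ).flip j, fun Λ hΛ =>
    exists_comp_add_of_le j hε.le Λ (hj Λ hΛ)⟩

end WeakCompactness

/-! ### Clopen subsets of the Stone space and their indicator functions -/

namespace StoneSpace

variable {A : Type*} [BooleanAlgebra A]

/-- The clopen set of the points of the Stone space that contain `a`. -/
def basicSet (a : A) : Set (StoneSpace A) := {x | x.toFun a = true}

theorem mem_basicSet {a : A} {x : StoneSpace A} : x ∈ basicSet a ↔ x.toFun a = true := Iff.rfl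

theorem continuous_toFun_apply (a : A) : Continuous fun x : StoneSpace A => x.toFun a :=
  (continuous_apply a).comp isClosedEmbedding_toFun.continuous

theorem isClopen_basicSet (a : A) : IsClopen (basicSet a) :=
  (isClopen_discrete {true}).preimage (continuous_toFun_apply a)

@[simp]
theorem mem_basicSet_sup {a b : A} {x : StoneSpace A} :
    x ∈ basicSet (a ⊔ b) ↔ x ∈ basicSet a ∨ x ∈ basicSet b := by
  have h : x.toFun (a ⊔ b) = (x.toFun a ⊔ x.toFun b) :=
    map_sup (show BoundedLatticeHom A Bool from x) a b
  rw [mem_basicSet, mem_basicSet, mem_basicSet, h]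
  simp

@[simp]
theorem mem_basicSet_inf {a b : A} {x : StoneSpace A} :
    x ∈ basicSet (a ⊓ b) ↔ x ∈ basicSet a ∧ x ∈ basicSet b := by
  have h : x.toFun (a ⊓ b) = (x.toFun a ⊓ x.toFun b) :=
    map_inf (show BoundedLatticeHom A Bool from x) a b
  rw [mem_basicSet, mem_basicSet, mem_basicSet, h]
  simp

@[simp]
theorem mem_basicSet_top {x : StoneSpace A} : x ∈ basicSet (⊤ : A) :=
  map_top (show BoundedLatticeHom A Bool from x)

@[simp]
theorem notMem_basicSet_bot {x : StoneSpace A} : x ∉ basicSet (⊥ : A) := by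
  have h : x.toFun ⊥ = ⊥ := map_bot (show BoundedLatticeHom A Bool from x)
  rw [mem_basicSet, h]
  simp

@[simp]
theorem mem_basicSet_compl {a : A} {x : StoneSpace A} : x ∈ basicSet aᶜ ↔ x ∉ basicSet a := by
  have h1 : x ∈ basicSet (a ⊔ aᶜ) := by rw [sup_compl_eq_top]; exact mem_basicSet_top
  have h2 : x ∉ basicSet (a ⊓ aᶜ) := by rw [inf_compl_eq_bot]; exact notMem_basicSet_bot
  rw [mem_basicSet_sup] at h1
  rw [mem_basicSet_inf] at h2
  tauto

@[simp]
theorem mem_basicSet_sdiff {a b : A} {x : StoneSpace A} :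
    x ∈ basicSet (a \ b) ↔ x ∈ basicSet a ∧ x ∉ basicSet b := by
  rw [_root_.sdiff_eq, mem_basicSet_inf, mem_basicSet_compl]

theorem basicSet_mono {a b : A} (h : a ≤ b) : basicSet a ⊆ basicSet b := by
  intro x hx
  rw [← inf_eq_left.2 h, mem_basicSet_inf] at hx
  exact hx.2

theorem notMem_basicSet_of_disjoint {a b : A} (h : Disjoint a b) {x : StoneSpace A}
    (hx : x ∈ basicSet a) : x ∉ basicSet b := fun hb =>
  notMem_basicSet_bot (h.eq_bot ▸ mem_basicSet_inf.2 ⟨hx, hb⟩)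

theorem exists_mem_basicSet_subset {U : Set (StoneSpace A)} (hU : IsOpen U) {x : StoneSpace A}
    (hx : x ∈ U) : ∃ a, x ∈ basicSet a ∧ basicSet a ⊆ U := by
  obtain ⟨V, hV, rfl⟩ := isOpen_induced_iff.1 hU
  obtain ⟨I, u, hI, hIV⟩ := isOpen_pi_iff.1 hV _ hx
  have key : ∀ I : Finset A, ∃ b, x ∈ basicSet b ∧
      ∀ y ∈ basicSet b, ∀ a ∈ I, y.toFun a = x.toFun a := by
    intro I
    classical
    induction I using Finset.induction_on with
    | empty => exact ⟨⊤, by simp⟩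
    | insert c I _ ih =>
      obtain ⟨b, hb, h⟩ := ih
      by_cases hc : x ∈ basicSet c
      · refine ⟨b ⊓ c, by simp [hb, hc], fun y hy a ha => ?_⟩
        rw [mem_basicSet_inf] at hy
        rcases Finset.mem_insert.1 ha with rfl | ha
        · exact hy.2.trans hc.symm
        · exact h y hy.1 a ha
      · refine ⟨b \ c, by simp [hb, hc], fun y hy a ha => ?_⟩
        rw [mem_basicSet_sdiff] at hy
        rcases Finset.mem_insert.1 ha with rfl | ha
        · have h1 := hy.2
          rw [mem_basicSet, Bool.not_eq_true] at h1 hc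
          rw [h1, hc]
        · exact h y hy.1 a ha
  obtain ⟨b, hb, h⟩ := key I
  exact ⟨b, hb, fun y hy => hIV fun a ha => by rw [h y hy a ha]; exact (hI a ha).2⟩

/-- Compactness of `Z`. It is applied to nested level sets of continuous functions, to replace them
by elements of the algebra. -/
theorem exists_basicSet_between {Z U : Set (StoneSpace A)} (hZ : IsClosed Z) (hU : IsOpen U)
    (hZU : Z ⊆ U) : ∃ a, Z ⊆ basicSet a ∧ basicSet a ⊆ U := by
  choose! v hv using fun z (hz : z ∈ Z) => exists_mem_basicSet_subset hU (hZU hz)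
  obtain ⟨t, htZ, ht⟩ := hZ.isCompact.elim_nhds_subcover (fun z => basicSet (v z))
    fun z hz => (isClopen_basicSet _).isOpen.mem_nhds (hv z hz).1
  have key : ∀ x, x ∈ basicSet (t.sup v) ↔ ∃ z ∈ t, x ∈ basicSet (v z) := by
    intro x
    clear ht htZ
    classical
    induction t using Finset.induction_on with
    | empty => simp
    | insert c I _ ih => simp [ih]
  refine ⟨t.sup v, fun x hx => ?_, fun x hx => ?_⟩
  · obtain ⟨z, hz, h⟩ := mem_iUnion₂.1 (ht hx)
    exact (key x).2 ⟨z, hz, h⟩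
  · obtain ⟨z, hz, h⟩ := (key x).1 hx
    exact (hv z (htZ z hz)).2 h

/-- The prime ideal theorem supplies a point: membership in the complement of a prime ideal that
avoids `a`. -/
theorem nonempty_basicSet {a : A} (ha : a ≠ ⊥) : (basicSet a).Nonempty := by
  obtain ⟨J, hJ, -, hdis⟩ := DistribLattice.prime_ideal_of_disjoint_filter_ideal
    (F := Order.PFilter.principal a) (I := Order.Ideal.principal ⊥) (by
      rw [Set.disjoint_left]
      intro b hb hb'
      have h1 : a ≤ b := hb
      have h2 : b ≤ ⊥ := hb'
      exact ha (le_bot_iff.1 (h1.trans h2)))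
  classical
  have htop : (⊤ : A) ∉ J := hJ.top_notMem
  have hsup : ∀ x y, x ⊔ y ∈ J ↔ x ∈ J ∧ y ∈ J := fun x y => Order.Ideal.sup_mem_iff
  have hinf : ∀ x y, x ⊓ y ∈ J ↔ x ∈ J ∨ y ∈ J := fun x y =>
    ⟨hJ.mem_or_mem, fun h => h.elim (fun h => J.lower inf_le_left h)
      (fun h => J.lower inf_le_right h)⟩
  let x : BoundedLatticeHom A Bool :=
    { toFun := fun b => decide (b ∉ J)
      map_sup' := by
        intro x y
        simp only [hsup]
        by_cases h1 : x ∈ J <;> by_cases h2 : y ∈ J <;> simp [h1, h2]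
      map_inf' := by
        intro x y
        simp only [hinf]
        by_cases h1 : x ∈ J <;> by_cases h2 : y ∈ J <;> simp [h1, h2]
      map_top' := by simpa using htop
      map_bot' := by simp }
  refine ⟨x, ?_⟩
  change decide (a ∉ J) = true
  rw [decide_eq_true_iff]
  exact fun h => Set.disjoint_left.1 hdis (show a ∈ Order.PFilter.principal a from le_refl a) h

theorem ne_bot_of_mem_basicSet {a : A} {x : StoneSpace A} (hx : x ∈ basicSet a) : a ≠ ⊥ := by
  rintro rfl
  exact notMem_basicSet_bot hx

theorem basicSet_subset_iff {a b : A} : basicSet a ⊆ basicSet b ↔ a ≤ b := by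
  refine ⟨fun h => ?_, basicSet_mono⟩
  by_contra hab
  obtain ⟨x, hx⟩ := nonempty_basicSet fun h0 : a \ b = ⊥ => hab (sdiff_eq_bot_iff.1 h0)
  rw [mem_basicSet_sdiff] at hx
  exact hx.2 (h hx.1)

theorem disjoint_of_basicSet {a b : A} (h : ∀ x ∈ basicSet a, x ∉ basicSet b) :
    Disjoint a b := by
  rw [disjoint_iff]
  by_contra hab
  obtain ⟨x, hx⟩ := nonempty_basicSet hab
  rw [mem_basicSet_inf] at hx
  exact h x hx.1 hx.2

noncomputable section

/-- The characteristic function of the clopen set given by an element of the algebra. -/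
def ind (a : A) : C(StoneSpace A, ℝ) :=
  ⟨(basicSet a).indicator 1, continuous_one.indicator fun x hx => by
    rw [(isClopen_basicSet a).frontier_eq] at hx
    exact hx.elim⟩

@[simp]
theorem ind_apply_of_mem {a : A} {x : StoneSpace A} (hx : x ∈ basicSet a) : ind a x = 1 :=
  indicator_of_mem hx _

@[simp]
theorem ind_apply_of_notMem {a : A} {x : StoneSpace A} (hx : x ∉ basicSet a) : ind a x = 0 :=
  indicator_of_notMem hx _

theorem ind_bot : ind (⊥ : A) = 0 := by
  ext x
  simp

theorem ind_sup {a b : A} (h : Disjoint a b) : ind (a ⊔ b) = ind a + ind b := by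
  ext x
  by_cases ha : x ∈ basicSet a
  · have hb := notMem_basicSet_of_disjoint h ha
    simp [ha, hb]
  · by_cases hb : x ∈ basicSet b <;> simp [ha, hb]

theorem ind_sdiff {a b : A} (h : b ≤ a) : ind (a \ b) = ind a - ind b := by
  rw [eq_sub_iff_add_eq, ← ind_sup disjoint_sdiff_self_left, sdiff_sup_cancel h]

theorem ind_mul_ind {a b : A} (h : a ≤ b) : ind b * ind a = ind a := by
  ext x
  by_cases ha : x ∈ basicSet a
  · simp [ha, basicSet_mono h ha]
  · simp [ha]

theorem ind_nonneg (a : A) (x : StoneSpace A) : 0 ≤ ind a x := by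
  by_cases ha : x ∈ basicSet a <;> simp [ha]

theorem abs_ind_le_one (a : A) (x : StoneSpace A) : |ind a x| ≤ 1 := by
  by_cases ha : x ∈ basicSet a <;> simp [ha]

theorem norm_ind_le_one (a : A) : ‖ind a‖ ≤ 1 :=
  (ContinuousMap.norm_le _ zero_le_one).2 (abs_ind_le_one a)

end

end StoneSpace

/-! ### Uniformly exhaustive families of submeasures -/

section Exhaustive

variable {ι B : Type*} [BooleanAlgebra B] {η : ι → B → ℝ}

/-- Otherwise successive differences along a subsequence of `c` would be disjoint and all large. -/
theorem exists_forall_sdiff_le_of_monotone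
    (hex : ∀ ε : ℝ, 0 < ε →
      ¬ ∃ a : ℕ → B, Pairwise (Function.onFun Disjoint a) ∧ ∀ k, ∃ i, ε < η i (a k))
    {c : ℕ → B} (hc : Monotone c) {ε : ℝ} (hε : 0 < ε) :
    ∃ N, ∀ M, N ≤ M → ∀ i, η i (c M \ c N) ≤ ε := by
  by_contra! h
  choose M hM hi using h
  let n : ℕ → ℕ := fun k => Nat.rec 0 (fun _ m => M m) k
  have hn : Monotone n := monotone_nat_of_le_succ fun k => hM (n k)
  refine hex ε hε ⟨fun k => c (n (k + 1)) \ c (n k), ?_, fun k => hi (n k)⟩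
  have key : ∀ k l, k < l → Disjoint (c (n (k + 1)) \ c (n k)) (c (n (l + 1)) \ c (n l)) :=
    fun k l hkl => Disjoint.mono_left (sdiff_le.trans (hc (hn hkl))) disjoint_sdiff_self_right
  intro k l hkl
  rcases lt_or_gt_of_ne hkl with h | h
  · exact key k l h
  · exact (key l k h).symm

theorem exists_forall_sdiff_le_of_antitone
    (hex : ∀ ε : ℝ, 0 < ε →
      ¬ ∃ a : ℕ → B, Pairwise (Function.onFun Disjoint a) ∧ ∀ k, ∃ i, ε < η i (a k))
    {c : ℕ → B} (hc : Antitone c) {ε : ℝ} (hε : 0 < ε) :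
    ∃ N, ∀ M, N ≤ M → ∀ i, η i (c N \ c M) ≤ ε := by
  have hc' : Monotone fun n => (c n)ᶜ := fun m n hmn => compl_le_compl (hc hmn)
  obtain ⟨N, hN⟩ := exists_forall_sdiff_le_of_monotone hex hc' hε
  exact ⟨N, fun M hM i => by simpa [_root_.sdiff_eq, inf_comm] using hN M hM i⟩

theorem le_sum_of_partialSups {μ : B → ℝ} (hsub : ∀ a b, μ (a ⊔ b) ≤ μ a + μ b) (a : ℕ → B)
    (n : ℕ) : μ (partialSups a n) ≤ ∑ k ∈ Finset.range (n + 1), μ (a k) := by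
  induction n with
  | zero => simp
  | succ n ih =>
    rw [← Order.succ_eq_add_one, partialSups_succ, Order.succ_eq_add_one, Finset.sum_range_succ]
    exact (hsub _ _).trans (by gcongr)

theorem sdiff_inf_le_sum {μ : B → ℝ} (hbot : μ ⊥ = 0) (hsub : ∀ a b, μ (a ⊔ b) ≤ μ a + μ b)
    (a : B) (d : ℕ → B) (n : ℕ) :
    μ (a \ (Finset.range n).inf d) ≤ ∑ k ∈ Finset.range n, μ (a \ d k) := by
  induction n with
  | zero => simp [hbot]
  | succ n ih =>
    rw [Finset.range_add_one, Finset.inf_insert, Finset.sum_insert Finset.notMem_range_self,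
      sdiff_inf]
    exact (hsub _ _).trans (by gcongr)

/-- A uniformly exhaustive family of submeasures is controlled by finitely many of its members. -/
theorem exists_finset_control (hbot : ∀ i, η i ⊥ = 0) (hmono : ∀ i, Monotone (η i))
    (hsub : ∀ i a b, η i (a ⊔ b) ≤ η i a + η i b)
    (hex : ∀ ε : ℝ, 0 < ε →
      ¬ ∃ a : ℕ → B, Pairwise (Function.onFun Disjoint a) ∧ ∀ k, ∃ i, ε < η i (a k))
    {ε : ℝ} (hε : 0 < ε) :
    ∃ (s : Finset ι) (δ : ℝ), 0 < δ ∧ ∀ a, (∀ i ∈ s, η i a < δ) → ∀ i, η i a ≤ ε := by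
  by_contra! hcon
  have hne : Nonempty ι := ⟨(hcon ∅ 1 one_pos).choose_spec.2.choose⟩
  choose! a has i hi using hcon
  classical
  -- `S n` collects the earlier indices `j m`: `b n` is large for `j n` but smaller than `2⁻ⁿ` for
  -- every earlier one.
  let S : ℕ → Finset ι := fun n => Nat.rec ∅ (fun n s => insert (i s ((1 / 2) ^ n)) s) n
  have hpos : ∀ n : ℕ, (0 : ℝ) < (1 / 2) ^ n := fun n => by positivity
  let b : ℕ → B := fun n => a (S n) ((1 / 2) ^ n)
  let j : ℕ → ι := fun n => i (S n) ((1 / 2) ^ n)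
  have hS : Monotone S := monotone_nat_of_le_succ fun n => Finset.subset_insert _ _
  have hjS : ∀ m n, m < n → j m ∈ S n := fun m n hmn =>
    hS hmn (Finset.mem_insert_self (j m) (S m))
  have hb : ∀ m n, m < n → η (j m) (b n) < (1 / 2) ^ n := fun m n hmn =>
    has (S n) _ (hpos n) _ (hjS m n hmn)
  have hbig : ∀ n, ε < η (j n) (b n) := fun n => hi (S n) _ (hpos n)
  choose N hN using fun k => exists_forall_sdiff_le_of_monotone hex
    (partialSups (fun m => b (k + m))).monotone
    (show 0 < ε / 4 * (1 / 2) ^ k by have := hpos k; positivity)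
  -- `d k` is a finite join of terms from `b k` on that nearly covers all later `b n`, uniformly in
  -- `i`. The decreasing meets `e n` thus still contain `b n` up to `ε / 2`.
  let d : ℕ → B := fun k => partialSups (fun m => b (k + m)) (N k)
  let e : ℕ → B := fun n => (Finset.range (n + 1)).inf d
  have he : Antitone e := fun m n hmn =>
    Finset.inf_mono (Finset.range_mono (Nat.succ_le_succ hmn))
  have hbd : ∀ i n k, k ≤ n → η i (b n \ d k) ≤ ε / 4 * (1 / 2) ^ k := by
    intro i n k hkn
    refine le_trans (hmono i ?_) (hN k (max (n - k) (N k)) (le_max_right _ _) i)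
    refine sdiff_le_sdiff_right ?_
    have h1 := le_partialSups_of_le (fun m => b (k + m)) (le_max_left (n - k) (N k))
    simpa [Nat.add_sub_cancel' hkn] using h1
  have hbe : ∀ i n, η i (b n \ e n) ≤ ε / 2 := by
    intro i n
    refine (sdiff_inf_le_sum (hbot i) (hsub i) _ _ _).trans ?_
    calc ∑ k ∈ Finset.range (n + 1), η i (b n \ d k)
        ≤ ∑ k ∈ Finset.range (n + 1), ε / 4 * (1 / 2) ^ k :=
          Finset.sum_le_sum fun k hk => hbd i n k (Nat.lt_succ_iff.1 (Finset.mem_range.1 hk))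
      _ = ε / 4 * ∑ k ∈ Finset.range (n + 1), (1 / 2 : ℝ) ^ k := by rw [Finset.mul_sum]
      _ ≤ ε / 4 * 2 := by
          gcongr
          exact sum_geometric_two_le _
      _ = ε / 2 := by ring
  have hle : ∀ i x y, η i x ≤ η i (x \ y) + η i y := fun i x y =>
    (hmono i (by rw [sdiff_sup_self]; exact le_sup_left)).trans (hsub i (x \ y) y)
  obtain ⟨J, hJ⟩ := exists_forall_sdiff_le_of_antitone hex he (show 0 < ε / 8 by positivity)
  obtain ⟨M₀, hM₀⟩ := exists_pow_lt_of_lt_one (show 0 < ε / 16 by positivity)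
    (show (1 / 2 : ℝ) < 1 by norm_num)
  let M := max M₀ (J + 1)
  have hM : (1 / 2 : ℝ) ^ M < ε / 16 :=
    (pow_le_pow_of_le_one (by norm_num) (by norm_num) (le_max_left _ _)).trans_lt hM₀
  -- Past `J` the `b n` are geometrically small for `j J`, hence so is their join `d M`. But `e` has
  -- nearly stabilised at `J`, so `b J` would have `η (j J)` at most `ε/2 + ε/8 + ε/8`.
  have hd : η (j J) (d M) ≤ ε / 8 := by
    refine (le_sum_of_partialSups (hsub _) _ _).trans ?_
    calc ∑ k ∈ Finset.range (N M + 1), η (j J) (b (M + k))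
        ≤ ∑ k ∈ Finset.range (N M + 1), (1 / 2) ^ M * (1 / 2 : ℝ) ^ k :=
          Finset.sum_le_sum fun k _ => by
            rw [← pow_add]
            exact (hb J (M + k) (by have := le_max_right M₀ (J + 1); omega)).le
      _ = (1 / 2) ^ M * ∑ k ∈ Finset.range (N M + 1), (1 / 2 : ℝ) ^ k := by rw [Finset.mul_sum]
      _ ≤ ε / 16 * 2 := by
          gcongr
          exact sum_geometric_two_le _
      _ = ε / 8 := by ring
  have h1 := hle (j J) (b J) (e J)
  have h2 := hle (j J) (e J) (e M)
  have h3 := hJ M (by have := le_max_right M₀ (J + 1); omega) (j J)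
  have h4 : η (j J) (e M) ≤ η (j J) (d M) :=
    hmono _ (Finset.inf_le (Finset.mem_range.2 (Nat.lt_succ_self M)))
  have h5 := hbe (j J) J
  have h6 := hbig J
  linarith

end Exhaustive

/-! ### Weak compactness of operators into the dual of `C(K)` for a Stone space `K` -/

namespace StoneSpace

universe u

variable {A : Type u} [BooleanAlgebra A]

/-- Peel off `(R / 3) 1_c` with `c` between `{f ≥ 2R/3}` and `{f > R/3}`. The remainder lies in `[0,
2R/3]`, and the costs `κ R / 3` form a geometric series with sum `κ R`. -/
theorem abs_apply_le_of_nonneg (L : StrongDual ℝ C(StoneSpace A, ℝ)) {a : A} {κ : ℝ}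
    (hL : ∀ b ≤ a, |L (ind b)| ≤ κ) (n : ℕ) :
    ∀ (R : ℝ) (f : C(StoneSpace A, ℝ)), 0 < R → (∀ x, 0 ≤ f x) → (∀ x, f x ≤ R) →
      (∀ x, x ∉ basicSet a → f x = 0) → |L f| ≤ κ * R + ‖L‖ * (2 / 3) ^ n * R := by
  have hκ : 0 ≤ κ := (abs_nonneg _).trans (hL a le_rfl)
  induction n with
  | zero =>
    intro R f hR h0 h1 _
    have hf : ‖f‖ ≤ R := (ContinuousMap.norm_le _ hR.le).2 fun x => by
      rw [Real.norm_of_nonneg (h0 x)]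
      exact h1 x
    have h2 : |L f| ≤ ‖L‖ * ‖f‖ := L.le_opNorm f
    have h3 : ‖L‖ * ‖f‖ ≤ ‖L‖ * R := by gcongr
    have h4 : 0 ≤ κ * R := by positivity
    simp only [pow_zero, mul_one]
    linarith
  | succ n ih =>
    intro R f hR h0 h1 ha
    obtain ⟨c, hc1, hc2⟩ := exists_basicSet_between (Z := {x | 2 * R / 3 ≤ f x})
      (U := {x | R / 3 < f x}) (isClosed_le continuous_const f.continuous)
      (isOpen_lt continuous_const f.continuous) (fun x hx => by
        have hx : 2 * R / 3 ≤ f x := hx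
        change R / 3 < f x
        linarith)
    have hca : c ≤ a := by
      rw [← basicSet_subset_iff]
      intro x hx
      by_contra hxa
      have h2 : R / 3 < f x := hc2 hx
      rw [ha x hxa] at h2
      linarith
    have hstep := ih (2 * R / 3) (f - (R / 3) • ind c) (by positivity) (fun x => by
        by_cases hx : x ∈ basicSet c
        · have h2 : R / 3 < f x := hc2 hx
          simp [hx, h2.le]
        · simp [hx, h0 x]) (fun x => by
        by_cases hx : x ∈ basicSet c
        · simp only [ContinuousMap.sub_apply, ContinuousMap.smul_apply, ind_apply_of_mem hx,
            smul_eq_mul]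
          linarith [h1 x]
        · have h2 : ¬ 2 * R / 3 ≤ f x := fun h => hx (hc1 h)
          simp only [ContinuousMap.sub_apply, ContinuousMap.smul_apply, ind_apply_of_notMem hx,
            smul_eq_mul]
          linarith) (fun x hx => by
        have h2 : x ∉ basicSet c := fun h => hx (basicSet_mono hca h)
        simp [h2, ha x hx])
    have h2 : L f = L (f - (R / 3) • ind c) + R / 3 * L (ind c) := by
      rw [map_sub, map_smul, smul_eq_mul]
      ring
    have h3 : |R / 3 * L (ind c)| ≤ R / 3 * κ := by
      rw [abs_mul, abs_of_pos (by positivity)]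
      gcongr
      exact hL c hca
    rw [h2]
    refine (abs_add_le _ _).trans ?_
    have h4 : ‖L‖ * (2 / 3) ^ n * (2 * R / 3) = ‖L‖ * (2 / 3) ^ (n + 1) * R := by
      rw [pow_succ]
      ring
    linarith

theorem abs_apply_le_of_forall_ind (L : StrongDual ℝ C(StoneSpace A, ℝ)) {a : A} {κ : ℝ}
    (hL : ∀ b ≤ a, |L (ind b)| ≤ κ) (f : C(StoneSpace A, ℝ))
    (hf : ∀ x, x ∉ basicSet a → f x = 0) : |L f| ≤ 2 * κ * ‖f‖ := by
  rcases eq_or_ne f 0 with rfl | hne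
  · simp
  have hR : 0 < ‖f‖ := norm_pos_iff.2 hne
  have key : ∀ g : C(StoneSpace A, ℝ), (∀ x, 0 ≤ g x) → (∀ x, g x ≤ ‖f‖) →
      (∀ x, x ∉ basicSet a → g x = 0) → |L g| ≤ κ * ‖f‖ := by
    intro g h0 h1 h2
    have hlim : Filter.Tendsto (fun n : ℕ => κ * ‖f‖ + ‖L‖ * (2 / 3) ^ n * ‖f‖) Filter.atTop
        (nhds (κ * ‖f‖ + ‖L‖ * 0 * ‖f‖)) :=
      tendsto_const_nhds.add (((tendsto_pow_atTop_nhds_zero_of_lt_one (by norm_num)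
        (by norm_num)).const_mul _).mul_const _)
    simp only [mul_zero, zero_mul, add_zero] at hlim
    exact ge_of_tendsto' hlim fun n => abs_apply_le_of_nonneg L hL n _ g hR h0 h1 h2
  have hx := fun x => abs_le.1 (f.norm_coe_le_norm x)
  have h1 := key (f ⊔ 0) (fun x => by simp) (fun x => by simpa using (hx x).2)
    (fun x hxa => by simp [hf x hxa])
  have h2 := key ((-f) ⊔ 0) (fun x => by simp)
    (fun x => by
      have := (hx x).1
      simp only [ContinuousMap.sup_apply, ContinuousMap.neg_apply, ContinuousMap.zero_apply]
      exact max_le (by linarith) hR.le)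
    (fun x hxa => by simp [hf x hxa])
  have h3 : f = (f ⊔ 0) - ((-f) ⊔ 0) := by
    ext x
    simp only [ContinuousMap.sub_apply, ContinuousMap.sup_apply, ContinuousMap.neg_apply,
      ContinuousMap.zero_apply]
    rcases le_total 0 (f x) with h | h <;> simp [h]
  rw [h3, map_sub, ← h3]
  refine (abs_sub _ _).trans ?_
  linarith

/-! ### Restrictions of functionals to clopen sets as submeasures. -/

noncomputable section

/-- The restriction of a functional to the clopen set given by `a`. -/
def restrict (L : StrongDual ℝ C(StoneSpace A, ℝ)) (a : A) : StrongDual ℝ C(StoneSpace A, ℝ) :=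
  L.comp (ContinuousLinearMap.mul ℝ C(StoneSpace A, ℝ) (ind a))

theorem restrict_apply (L : StrongDual ℝ C(StoneSpace A, ℝ)) (a : A) (f : C(StoneSpace A, ℝ)) :
    restrict L a f = L (ind a * f) := rfl

theorem norm_ind_mul_le (a : A) (f : C(StoneSpace A, ℝ)) : ‖ind a * f‖ ≤ ‖f‖ :=
  (norm_mul_le _ _).trans (mul_le_of_le_one_left (norm_nonneg _) (norm_ind_le_one a))

theorem restrict_bot (L : StrongDual ℝ C(StoneSpace A, ℝ)) : restrict L ⊥ = 0 := by
  ext f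
  rw [restrict_apply, ind_bot, zero_mul, map_zero]
  rfl

theorem norm_restrict_mono (L : StrongDual ℝ C(StoneSpace A, ℝ)) :
    Monotone fun a => ‖restrict L a‖ := by
  intro a b hab
  change ‖restrict L a‖ ≤ ‖restrict L b‖
  refine ContinuousLinearMap.opNorm_le_bound _ (norm_nonneg (restrict L b)) fun f => ?_
  have h : restrict L a f = restrict L b (ind a * f) := by
    rw [restrict_apply, restrict_apply, ← mul_assoc, ind_mul_ind hab]
  rw [h]
  exact (ContinuousLinearMap.le_opNorm _ _).trans
    (mul_le_mul_of_nonneg_left (norm_ind_mul_le a f) (norm_nonneg _))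

theorem norm_restrict_sup_le (L : StrongDual ℝ C(StoneSpace A, ℝ)) (a b : A) :
    ‖restrict L (a ⊔ b)‖ ≤ ‖restrict L a‖ + ‖restrict L b‖ := by
  have h : restrict L (a ⊔ b) = restrict L a + restrict L (b \ a) := by
    ext f
    rw [_root_.add_apply, restrict_apply, restrict_apply, restrict_apply, ← map_add, ← add_mul,
      ← ind_sup disjoint_sdiff_self_right, sup_sdiff_self_right]
  rw [h]
  have h1 : ‖restrict L (b \ a)‖ ≤ ‖restrict L b‖ := norm_restrict_mono L sdiff_le
  exact (norm_add_le (restrict L a) (restrict L (b \ a))).trans (add_le_add le_rfl h1)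

theorem norm_restrict_le_of_forall_ind (L : StrongDual ℝ C(StoneSpace A, ℝ)) {a : A} {κ : ℝ}
    (hL : ∀ b ≤ a, |L (ind b)| ≤ κ) : ‖restrict L a‖ ≤ 2 * κ := by
  have hκ : 0 ≤ κ := (abs_nonneg _).trans (hL a le_rfl)
  refine ContinuousLinearMap.opNorm_le_bound _ (by positivity) fun f => ?_
  rw [restrict_apply]
  refine (abs_apply_le_of_forall_ind L hL _ fun x hx => ?_).trans ?_
  · simp [hx]
  · exact mul_le_mul_of_nonneg_left (norm_ind_mul_le a f) (by positivity)

theorem norm_restrict_le_integral {L : StrongDual ℝ C(StoneSpace A, ℝ)}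
    {P N : Measure (StoneSpace A)} [IsFiniteMeasure P] [IsFiniteMeasure N]
    (h : ∀ f : C(StoneSpace A, ℝ), L f = ∫ x, f x ∂P - ∫ x, f x ∂N) (a : A) :
    ‖restrict L a‖ ≤ ∫ x, ind a x ∂P + ∫ x, ind a x ∂N := by
  have h0 : ∀ ν : Measure (StoneSpace A), 0 ≤ ∫ x, ind a x ∂ν := fun ν =>
    integral_nonneg (ind_nonneg a)
  refine ContinuousLinearMap.opNorm_le_bound _ (add_nonneg (h0 P) (h0 N)) fun f => ?_
  have key : ∀ (ν : Measure (StoneSpace A)) [IsFiniteMeasure ν],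
      |∫ x, (ind a * f) x ∂ν| ≤ (∫ x, ind a x ∂ν) * ‖f‖ := by
    intro ν _
    rw [← integral_mul_const, ← Real.norm_eq_abs]
    refine norm_integral_le_of_norm_le ((integrable_continuousMap ν (ind a)).mul_const _)
      (Filter.Eventually.of_forall fun x => ?_)
    rw [ContinuousMap.mul_apply, norm_mul, Real.norm_of_nonneg (ind_nonneg a x)]
    exact mul_le_mul_of_nonneg_left (f.norm_coe_le_norm x) (ind_nonneg a x)
  rw [restrict_apply, h, add_mul]
  exact (abs_sub _ _).trans (add_le_add (key P) (key N))

/-- Cauchy–Schwarz against `1`; it trades the `L¹` bound for one by a Hilbert space norm. -/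
theorem integral_abs_le_norm_toLp {K : Type*} [TopologicalSpace K] [CompactSpace K]
    [MeasurableSpace K] [BorelSpace K] (ν : Measure K) [IsFiniteMeasure ν] (f : C(K, ℝ)) :
    ∫ x, |f x| ∂ν ≤
      ‖ContinuousMap.toLp (E := ℝ) 2 ν ℝ 1‖ * ‖ContinuousMap.toLp (E := ℝ) 2 ν ℝ f‖ := by
  have h1 := ContinuousMap.inner_toLp (𝕜 := ℝ) ν 1 |f|
  have h2 : ‖ContinuousMap.toLp (E := ℝ) 2 ν ℝ |f|‖ = ‖ContinuousMap.toLp (E := ℝ) 2 ν ℝ f‖ := by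
    rw [← sq_eq_sq₀ (norm_nonneg _) (norm_nonneg _), ← real_inner_self_eq_norm_sq,
      ← real_inner_self_eq_norm_sq, ContinuousMap.inner_toLp, ContinuousMap.inner_toLp]
    simp
  have h3 : ∫ x, |f x| ∂ν = inner ℝ (ContinuousMap.toLp (E := ℝ) 2 ν ℝ 1)
      (ContinuousMap.toLp (E := ℝ) 2 ν ℝ |f|) := by
    rw [h1]
    simp
  rw [h3, ← h2]
  exact real_inner_le_norm _ _

theorem exists_measure_of_norm_restrict_le {ι : Type*} (L : ι → StrongDual ℝ C(StoneSpace A, ℝ))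
    (s : Finset ι) : ∃ ν : Measure (StoneSpace A), IsFiniteMeasure ν ∧
      ∀ i ∈ s, ∀ a, ‖restrict (L i) a‖ ≤ ∫ x, ind a x ∂ν := by
  choose P N hP hN _ _ hL _ using fun i => exists_measure_decomposition (L i)
  refine ⟨∑ i ∈ s, (P i + N i), inferInstance, fun i hi a => ?_⟩
  rw [integral_finsetSum_measure fun i _ => integrable_continuousMap _ _]
  refine (norm_restrict_le_integral (hL i) a).trans ?_
  rw [← integral_add_measure (integrable_continuousMap _ _) (integrable_continuousMap _ _)]
  exact Finset.single_le_sum (f := fun i => ∫ x, ind a x ∂(P i + N i))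
    (fun i _ => integral_nonneg (ind_nonneg a)) hi

/-- A functional that is small on clopen sets of small measure is dominated by the `L¹`-norm, up to
a small multiple of the supremum norm. -/
theorem abs_apply_le_integral_abs_add {L : StrongDual ℝ C(StoneSpace A, ℝ)}
    {ν : Measure (StoneSpace A)} [IsFiniteMeasure ν] {C ε δ : ℝ} (hC : 0 < C) (hε : 0 < ε)
    (hδ : 0 < δ) (hL : ‖L‖ ≤ C)
    (h : ∀ a, ∫ x, ind a x ∂ν < δ → ‖restrict L a‖ ≤ ε / 2) (f : C(StoneSpace A, ℝ)) :
    |L f| ≤ 4 * C ^ 2 / (δ * ε) * ∫ x, |f x| ∂ν + ε * ‖f‖ := by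
  rcases eq_or_ne f 0 with rfl | hne
  · simp
  have hR : 0 < ‖f‖ := norm_pos_iff.2 hne
  have hI : 0 ≤ ∫ x, |f x| ∂ν := integral_nonneg fun x => abs_nonneg _
  -- Chosen so that `C t = (ε / 2) ‖f‖`: the part of `f` below `t` costs half of the error term.
  set t := ε / (2 * C) * ‖f‖ with ht
  have htpos : 0 < t := by positivity
  obtain ⟨a, ha1, ha2⟩ := exists_basicSet_between (Z := {x | t ≤ |f x|})
    (U := {x | t / 2 < |f x|}) (isClosed_le continuous_const f.continuous.abs)
    (isOpen_lt continuous_const f.continuous.abs) (fun x hx => by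
      have hx : t ≤ |f x| := hx
      change t / 2 < |f x|
      linarith)
  rcases lt_or_ge (∫ x, ind a x ∂ν) δ with hlt | hge
  · have h1 : f = ind a * f + (f - ind a * f) := by abel
    have h2 : |L (ind a * f)| ≤ ε / 2 * ‖f‖ :=
      ((restrict L a).le_opNorm f).trans (mul_le_mul_of_nonneg_right (h a hlt) (norm_nonneg _))
    have h3 : ‖f - ind a * f‖ ≤ t := by
      refine (ContinuousMap.norm_le _ htpos.le).2 fun x => ?_
      by_cases hx : x ∈ basicSet a
      · simp [hx, htpos.le]
      · have h4 : ¬ t ≤ |f x| := fun h => hx (ha1 h)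
        simp [hx, (not_le.1 h4).le]
    have h4 : |L (f - ind a * f)| ≤ C * t :=
      (L.le_opNorm _).trans (mul_le_mul hL h3 (norm_nonneg _) hC.le)
    have h5 : C * t = ε / 2 * ‖f‖ := by
      rw [ht]
      field_simp
    have h6 : |L f| ≤ ε * ‖f‖ := by
      rw [h1, map_add, ← h1]
      refine (abs_add_le _ _).trans ?_
      linarith
    exact h6.trans (le_add_of_nonneg_left (by positivity))
  -- Chebyshev: if `a` is not small, the `L¹`-norm is so large that the first term alone exceeds `C
  -- ‖f‖`.
  · have h1 : t / 2 * δ ≤ ∫ x, |f x| ∂ν := by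
      refine (mul_le_mul_of_nonneg_left hge (by positivity)).trans ?_
      rw [← integral_const_mul]
      refine integral_mono ((integrable_continuousMap ν _).const_mul _)
        (integrable_continuousMap ν f).abs fun x => ?_
      by_cases hx : x ∈ basicSet a
      · have h2 : t / 2 < |f x| := ha2 hx
        simpa [hx] using h2.le
      · simp [hx]
    have h2 : |L f| ≤ C * ‖f‖ := (L.le_opNorm f).trans (by gcongr)
    have h3 : C * ‖f‖ = 4 * C ^ 2 / (δ * ε) * (t / 2 * δ) := by
      rw [ht]
      field_simp
      ring
    have h4 : 4 * C ^ 2 / (δ * ε) * (t / 2 * δ) ≤ 4 * C ^ 2 / (δ * ε) * ∫ x, |f x| ∂ν := by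
      gcongr
    have h5 : 0 ≤ ε * ‖f‖ := by positivity
    linarith

theorem exists_norm_apply_le {X F : Type*} [NormedAddCommGroup X] [NormedSpace ℝ X]
    [NormedAddCommGroup F] [NormedSpace ℝ F] (S : X →L[ℝ] F) :
    ∃ C : ℝ, 0 < C ∧ ∀ x, ‖x‖ ≤ 1 → ‖S x‖ ≤ C :=
  ⟨‖S‖ + 1, by positivity, fun x hx =>
    (S.le_opNorm x).trans (by nlinarith [norm_nonneg S])⟩

/-- An operator into the dual of `C(K)`, `K` a Stone space, is weakly compact if the image of the
unit ball is uniformly small on the members of disjoint sequences of clopen sets. -/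
theorem isWeaklyCompactOperator_of_exhaustive {X : Type*} [NormedAddCommGroup X]
    [NormedSpace ℝ X] (S : X →L[ℝ] StrongDual ℝ C(StoneSpace A, ℝ))
    (hS : ∀ ε : ℝ, 0 < ε → ¬ ∃ b : ℕ → A, Pairwise (Function.onFun Disjoint b) ∧
      ∀ k, ∃ x, ‖x‖ ≤ 1 ∧ ε < |S x (ind (b k))|) :
    IsWeaklyCompactOperator (E := X) (F := StrongDual ℝ C(StoneSpace A, ℝ)) S := by
  obtain ⟨C, hC, hnorm⟩ := exists_norm_apply_le (F := StrongDual ℝ C(StoneSpace A, ℝ)) S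
  have himage : (fun x => toWeakSpace ℝ _ (S x)) '' Metric.closedBall (0 : X) 1 =
      toWeakSpace ℝ (StrongDual ℝ C(StoneSpace A, ℝ)) '' (S '' Metric.closedBall 0 1) := by
    rw [image_image]
  rw [IsWeaklyCompactOperator, himage]
  refine isCompact_closure_toWeakSpace_of_hilbert_bound
    (isBounded_iff_forall_norm_le.2 ⟨C, ?_⟩) fun ε hε => ?_
  · rintro _ ⟨x, hx, rfl⟩
    exact hnorm x (mem_closedBall_zero_iff.1 hx)
  obtain ⟨s, δ, hδ, hs⟩ := exists_finset_control (ι := {x : X // ‖x‖ ≤ 1})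
    (η := fun x a => ‖restrict (S x) a‖) (fun x => by
      rw [restrict_bot]
      exact ContinuousLinearMap.opNorm_zero)
    (fun x => norm_restrict_mono _) (fun x => norm_restrict_sup_le _) (by
      rintro ε hε ⟨a, ha, hx⟩
      choose x hx using hx
      -- The norm of a restriction is at most twice its supremum over indicators, and `2 ε / 3 < ε`.
      have h1 : ∀ k, ∃ b ≤ a k, ε / 3 < |S (x k) (ind b)| := by
        intro k
        by_contra! h
        have := norm_restrict_le_of_forall_ind _ h
        linarith [hx k]
      choose b hb h using h1
      exact hS (ε / 3) (by positivity) ⟨b, fun k l hkl => (ha hkl).mono (hb k) (hb l),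
        fun k => ⟨x k, (x k).2, h k⟩⟩) (half_pos hε)
  obtain ⟨ν, hν, hνs⟩ := exists_measure_of_norm_restrict_le
    (fun x : {x : X // ‖x‖ ≤ 1} => S x) s
  let M : ℝ := 4 * C ^ 2 / (δ * ε)
  let c : ℝ := ‖ContinuousMap.toLp (E := ℝ) 2 ν ℝ 1‖
  refine ⟨Lp ℝ 2 ν, inferInstance, inferInstance, inferInstance,
    (M * c) • ContinuousMap.toLp (E := ℝ) 2 ν ℝ, ?_⟩
  rintro _ ⟨x, hx, rfl⟩ f
  rw [mem_closedBall_zero_iff] at hx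
  refine (abs_apply_le_integral_abs_add hC hε hδ (hnorm x hx) (fun a ha => hs a
    (fun i hi => (hνs i hi a).trans_lt ha) ⟨x, hx⟩) f).trans ?_
  refine add_le_add ?_ le_rfl
  have hM : 0 ≤ M := by positivity
  rw [_root_.smul_apply, norm_smul, Real.norm_of_nonneg (mul_nonneg hM (norm_nonneg _)), mul_assoc]
  exact mul_le_mul_of_nonneg_left (integral_abs_le_norm_toLp ν f) hM

end

end StoneSpace

/-! ### Operators that are negligible off the support -/

namespace StoneSpace

variable {A : Type*} [BooleanAlgebra A]

/-- `T 1_{b n} (y n)` is not bounded away from zero whenever the `b n` are pairwise disjoint and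
`y n` lies outside of `b n`. -/
def NegligibleOffSupport (T : C(StoneSpace A, ℝ) →L[ℝ] C(StoneSpace A, ℝ)) : Prop :=
  ∀ ε : ℝ, 0 < ε → ∀ (b : ℕ → A) (y : ℕ → StoneSpace A), Pairwise (Function.onFun Disjoint b) →
    (∀ n, y n ∉ basicSet (b n)) → ¬ ∀ n, ε < |T (ind (b n)) (y n)|

variable {T : C(StoneSpace A, ℝ) →L[ℝ] C(StoneSpace A, ℝ)}

theorem abs_apply_ind_le (T : C(StoneSpace A, ℝ) →L[ℝ] C(StoneSpace A, ℝ)) (a : A)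
    (x : StoneSpace A) : |T (ind a) x| ≤ ‖T‖ :=
  ((T (ind a)).norm_coe_le_norm x).trans ((T.le_opNorm _).trans
    (mul_le_of_le_one_right (norm_nonneg _) (norm_ind_le_one a)))

theorem apply_ind_sdiff {a b : A} (h : b ≤ a) (x : StoneSpace A) :
    T (ind (a \ b)) x = T (ind a) x - T (ind b) x := by
  rw [ind_sdiff h, map_sub, ContinuousMap.sub_apply]

/-- If every neighbourhood of `x` contained a bad `b` missing `x`, deleting bad sets one after
another would give a disjoint sequence contradicting negligibility. -/
theorem NegligibleOffSupport.exists_mem_basicSet (hT : NegligibleOffSupport T)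
    (x : StoneSpace A) {ε : ℝ} (hε : 0 < ε) :
    ∃ v, x ∈ basicSet v ∧ ∀ b ≤ v, x ∉ basicSet b → ∀ z, z ∉ basicSet b →
      |T (ind b) z| ≤ ε := by
  by_contra! h
  have hne : Nonempty (StoneSpace A) := ⟨x⟩
  choose! b hbv hxb z hzb hz using h
  let v : ℕ → A := fun n => Nat.rec ⊤ (fun _ w => w \ b w) n
  have hxv : ∀ n, x ∈ basicSet (v n) := by
    intro n
    induction n with
    | zero => exact mem_basicSet_top
    | succ n ih => exact mem_basicSet_sdiff.2 ⟨ih, hxb _ ih⟩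
  have hv : Antitone v := antitone_nat_of_succ_le fun n => sdiff_le
  have key : ∀ m n, m < n → Disjoint (b (v m)) (b (v n)) := fun m n hmn =>
    Disjoint.mono_right ((hbv _ (hxv n)).trans (hv (Nat.succ_le_of_lt hmn)))
      (disjoint_sdiff_self_right : Disjoint (b (v m)) (v m \ b (v m)))
  refine hT ε hε (fun n => b (v n)) (fun n => z (v n)) (fun m n hmn => ?_)
    (fun n => hzb _ (hxv n)) fun n => hz _ (hxv n)
  rcases lt_or_gt_of_ne hmn with h | h
  · exact key m n h
  · exact (key n m h).symm

/-- Shrinking a small neighbourhood `u` to `w ∋ x` removes a set missing `x`, so the values at `x`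
form a Cauchy net. -/
theorem NegligibleOffSupport.exists_limit (hT : NegligibleOffSupport T) (x : StoneSpace A) :
    ∃ r : ℝ, ∀ ε : ℝ, 0 < ε → ∃ v, x ∈ basicSet v ∧ ∀ w ≤ v, x ∈ basicSet w →
      |T (ind w) x - r| ≤ ε := by
  have hpos : ∀ n : ℕ, (0 : ℝ) < (1 / 2) ^ n := fun n => by positivity
  choose v hxv hv using fun n : ℕ => hT.exists_mem_basicSet x (hpos n)
  let u : ℕ → A := fun n => Nat.rec (v 0) (fun n w => w ⊓ v (n + 1)) n
  have hu : Antitone u := antitone_nat_of_succ_le fun n => inf_le_left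
  have huv : ∀ n, u n ≤ v n := fun n => by
    cases n with
    | zero => exact le_rfl
    | succ n => exact inf_le_right
  have hxu : ∀ n, x ∈ basicSet (u n) := by
    intro n
    induction n with
    | zero => exact hxv 0
    | succ n ih => exact mem_basicSet_inf.2 ⟨ih, hxv _⟩
  have key : ∀ n, ∀ w ≤ u n, x ∈ basicSet w →
      |T (ind (u n)) x - T (ind w) x| ≤ (1 / 2) ^ n := by
    intro n w hw hxw
    have hx : x ∉ basicSet (u n \ w) := fun h => (mem_basicSet_sdiff.1 h).2 hxw
    rw [← apply_ind_sdiff hw]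
    exact hv n _ (sdiff_le.trans (huv n)) hx x hx
  have hc : CauchySeq fun n => T (ind (u n)) x := by
    refine cauchySeq_of_le_geometric (1 / 2) 1 (by norm_num) fun n => ?_
    rw [Real.dist_eq, one_mul]
    exact key n _ (hu (Nat.le_succ n)) (hxu (n + 1))
  obtain ⟨r, hr⟩ := cauchySeq_tendsto_of_complete hc
  refine ⟨r, fun ε hε => ?_⟩
  obtain ⟨n, hn⟩ := exists_pow_lt_of_lt_one (half_pos hε) (show (1 / 2 : ℝ) < 1 by norm_num)
  have hr' : |T (ind (u n)) x - r| ≤ (1 / 2) ^ n := by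
    refine le_of_tendsto (hr.const_sub (T (ind (u n)) x)).abs
      (Filter.eventually_atTop.2 ⟨n, fun m hm => key n _ (hu hm) (hxu m)⟩)
  refine ⟨u n, hxu n, fun w hw hxw => ?_⟩
  have h1 := abs_le.1 (key n w hw hxw)
  have h2 := abs_le.1 hr'
  exact abs_le.2 ⟨by linarith, by linarith⟩

noncomputable section

/-- The mass at `x` of the measure that represents `f ↦ T f x`. -/
def NegligibleOffSupport.diag (hT : NegligibleOffSupport T) (x : StoneSpace A) : ℝ :=
  (hT.exists_limit x).choose

theorem NegligibleOffSupport.diag_spec (hT : NegligibleOffSupport T) (x : StoneSpace A) {ε : ℝ}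
    (hε : 0 < ε) : ∃ v, x ∈ basicSet v ∧ ∀ w ≤ v, x ∈ basicSet w →
      |T (ind w) x - hT.diag x| ≤ ε :=
  (hT.exists_limit x).choose_spec ε hε

theorem NegligibleOffSupport.exists_le_diag (hT : NegligibleOffSupport T) {x : StoneSpace A}
    {a : A} (hx : x ∈ basicSet a) {ε : ℝ} (hε : 0 < ε) :
    ∃ w ≤ a, x ∈ basicSet w ∧ |T (ind w) x - hT.diag x| ≤ ε := by
  obtain ⟨v, hxv, hv⟩ := hT.diag_spec x hε
  have h : x ∈ basicSet (v ⊓ a) := mem_basicSet_inf.2 ⟨hxv, hx⟩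
  exact ⟨v ⊓ a, inf_le_right, h, hv _ inf_le_left h⟩

theorem NegligibleOffSupport.abs_diag_le (hT : NegligibleOffSupport T) (x : StoneSpace A) :
    |hT.diag x| ≤ ‖T‖ := by
  refine le_of_forall_pos_le_add fun ε hε => ?_
  obtain ⟨w, -, -, hw⟩ := hT.exists_le_diag (mem_basicSet_top (x := x)) hε
  have h1 := abs_apply_ind_le T w x
  have h2 := abs_sub_abs_le_abs_sub (hT.diag x) (T (ind w) x)
  rw [abs_sub_comm] at hw
  linarith

/-- The exceptional points are the centres of a finite cover. Any other `y` has a neighbourhood `w`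
missing its centre, on which the diagonal is within `2ε/5` of the continuous function `T 1_w`. -/
theorem NegligibleOffSupport.exists_finite_oscillation (hT : NegligibleOffSupport T) {ε : ℝ}
    (hε : 0 < ε) : ∃ F : Set (StoneSpace A), F.Finite ∧ ∀ y ∉ F, ∃ U ∈ nhds y,
      ∀ z ∈ U, |hT.diag z - hT.diag y| ≤ ε := by
  choose v hxv hv using fun x => hT.exists_mem_basicSet x (show 0 < ε / 5 by positivity)
  obtain ⟨t, -, ht⟩ := isCompact_univ.elim_nhds_subcover (fun x : StoneSpace A => basicSet (v x))
    fun x _ => (isClopen_basicSet _).isOpen.mem_nhds (hxv x)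
  refine ⟨t, t.finite_toSet, fun y hy => ?_⟩
  obtain ⟨x, hxt, hyx⟩ := mem_iUnion₂.1 (ht (mem_univ y))
  have hne : y ≠ x := fun h => hy (h ▸ hxt)
  obtain ⟨w, hyw, hw⟩ := exists_mem_basicSet_subset
    ((isClopen_basicSet (v x)).isOpen.inter isOpen_compl_singleton) (x := y) ⟨hyx, hne⟩
  have hwv : w ≤ v x := basicSet_subset_iff.1 fun z hz => (hw hz).1
  have hxw : x ∉ basicSet w := fun h => (hw h).2 rfl
  have key : ∀ z ∈ basicSet w, |T (ind w) z - hT.diag z| ≤ ε / 5 + ε / 5 := by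
    intro z hz
    obtain ⟨w', hw', hzw', h⟩ := hT.exists_le_diag hz (show 0 < ε / 5 by positivity)
    have h1 := hv x (w \ w') (sdiff_le.trans hwv) (fun h => hxw (mem_basicSet_sdiff.1 h).1) z
      (fun h => (mem_basicSet_sdiff.1 h).2 hzw')
    rw [apply_ind_sdiff hw'] at h1
    have h2 := abs_sub_le (T (ind w) z) (T (ind w') z) (hT.diag z)
    linarith
  have hc : {z | |T (ind w) z - T (ind w) y| < ε / 5} ∈ nhds y :=
    (isOpen_lt (by fun_prop) continuous_const).mem_nhds (by simpa using hε)
  refine ⟨_, Filter.inter_mem ((isClopen_basicSet w).isOpen.mem_nhds hyw) hc, fun z hz => ?_⟩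
  have h1 := abs_le.1 (key z hz.1)
  have h2 := abs_le.1 (key y hyw)
  have h3 : |T (ind w) z - T (ind w) y| < ε / 5 := hz.2
  have h4 := abs_lt.1 h3
  exact abs_le.2 ⟨by linarith, by linarith⟩

theorem NegligibleOffSupport.measurable_diag (hT : NegligibleOffSupport T) :
    Measurable hT.diag := by
  have hpos : ∀ n : ℕ, (0 : ℝ) < (1 / 2) ^ n := fun n => by positivity
  choose F hF hosc using fun n : ℕ => hT.exists_finite_oscillation (hpos n)
  refine measurable_of_countable_not_continuousAt
    ((countable_iUnion fun n => (hF n).countable).mono fun y hy => ?_)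
  by_contra hyF
  refine hy (Metric.continuousAt_iff'.2 fun ε hε => ?_)
  obtain ⟨n, hn⟩ := exists_pow_lt_of_lt_one hε (show (1 / 2 : ℝ) < 1 by norm_num)
  obtain ⟨U, hU, h⟩ := hosc n y fun h => hyF (mem_iUnion.2 ⟨n, h⟩)
  filter_upwards [hU] with z hz
  exact (h z hz).trans_lt hn

/-- When `y n ∈ b n`, cutting out a small neighbourhood of `y n` subtracts the diagonal term
approximately and moves the point off the support. -/
theorem NegligibleOffSupport.not_forall_lt_abs_sub (hT : NegligibleOffSupport T) {ε : ℝ}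
    (hε : 0 < ε) {b : ℕ → A} (hb : Pairwise (Function.onFun Disjoint b))
    (y : ℕ → StoneSpace A) :
    ¬ ∀ n, ε < |T (ind (b n)) (y n) - ind (b n) (y n) * hT.diag (y n)| := by
  intro h
  have key : ∀ n, ∃ c ≤ b n, y n ∉ basicSet c ∧ ε / 2 < |T (ind c) (y n)| := by
    intro n
    have hn := h n
    by_cases hy : y n ∈ basicSet (b n)
    · rw [ind_apply_of_mem hy, one_mul] at hn
      obtain ⟨w, hw, hyw, hwd⟩ := hT.exists_le_diag hy (half_pos hε)
      refine ⟨b n \ w, sdiff_le, fun h => (mem_basicSet_sdiff.1 h).2 hyw, ?_⟩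
      rw [apply_ind_sdiff hw]
      have h2 := abs_sub_le (T (ind (b n)) (y n)) (T (ind w) (y n)) (hT.diag (y n))
      linarith
    · rw [ind_apply_of_notMem hy, zero_mul, sub_zero] at hn
      exact ⟨b n, le_rfl, hy, by linarith⟩
  choose c hc hyc hTc using key
  exact hT (ε / 2) (half_pos hε) c y (fun m n hmn => (hb hmn).mono (hc m) (hc n)) hyc hTc

/-- With `S = T* - g`, the number `S Λ (1_b)` integrates `T 1_b - 1_b g` against `Λ`. If it is large
for some `Λ` in the unit ball, the integrand is large at a point. -/
theorem NegligibleOffSupport.isWeakMultiplier (hT : NegligibleOffSupport T) :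
    IsWeakMultiplier T := by
  have hg := hT.measurable_diag
  have hC := hT.abs_diag_le
  refine ⟨hT.diag, hg, ⟨‖T‖, hC⟩, dualOperator T - mulDual hT.diag hg ‖T‖ hC, ?_, ?_⟩
  · refine isWeaklyCompactOperator_of_exhaustive _ ?_
    rintro ε hε ⟨b, hb, hx⟩
    choose Λ hΛ hlt using hx
    have key : ∀ k, ∃ y, ε / 2 < |T (ind (b k)) y - ind (b k) y * hT.diag y| := by
      intro k
      by_contra! hle
      obtain ⟨P, N, _, _, _, _, h, hn⟩ := exists_measure_decomposition (Λ k)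
      have h1 : (dualOperator T - mulDual hT.diag hg ‖T‖ hC) (Λ k) (ind (b k)) =
          ∫ y, (T (ind (b k)) y - ind (b k) y * hT.diag y) ∂P -
            ∫ y, (T (ind (b k)) y - ind (b k) y * hT.diag y) ∂N := by
        change Λ k (T (ind (b k))) - mulDual hT.diag hg ‖T‖ hC (Λ k) (ind (b k)) = _
        rw [mulDual_apply hg hC h, h,
          integral_sub (integrable_continuousMap _ _) (integrable_mul_bounded hg hC _ _),
          integral_sub (integrable_continuousMap _ _) (integrable_mul_bounded hg hC _ _)]
        ring
      have h2 := hlt k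
      rw [h1] at h2
      have h3 := abs_integral_sub_integral_le (P := P) (N := N) hle
      have h4 : ε / 2 * (P.real univ + N.real univ) ≤ ε / 2 * 1 := by
        gcongr
        exact hn.trans (hΛ k)
      linarith
    choose y hy using key
    exact hT.not_forall_lt_abs_sub (half_pos hε) hb y hy
  · intro μ hμ f
    rw [← mulDual_signedFunctional hg hC hμ]
    change _ = _ + (dualOperator T (signedFunctional μ) f - _)
    exact (add_sub_cancel _ _).symm

end

end StoneSpace

/-! ### Combinatorial tools -/

section Combinatorics

/-- Pairing splits `ℕ` into infinitely many infinite blocks. Either one block works, or each block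
has an index whose sum inside the block exceeds `ε`; one such index per block gives a submatrix
whose bound has dropped by `ε`. -/
theorem exists_injective_sum_le_aux {ε : ℝ} (N : ℕ) :
    ∀ c : ℕ → ℕ → ℝ, (∀ n m, 0 ≤ c n m) →
      (∀ n (s : Finset ℕ), n ∉ s → ∑ m ∈ s, c n m ≤ (N + 1) * ε) →
      ∃ k : ℕ → ℕ, Function.Injective k ∧
        ∀ n (s : Finset ℕ), n ∉ s → ∑ m ∈ s, c (k n) (k m) ≤ ε := by
  induction N with
  | zero =>
    intro c _ h
    exact ⟨id, Function.injective_id, fun n s hs => by simpa using h n s hs⟩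
  | succ N ih =>
    intro c hc h
    by_cases hp : ∃ p, ∀ q (s : Finset ℕ), q ∉ s →
        ∑ r ∈ s, c (Nat.pair p q) (Nat.pair p r) ≤ ε
    · obtain ⟨p, hp⟩ := hp
      exact ⟨Nat.pair p, fun q r hqr => (Nat.pair_eq_pair.1 hqr).2, hp⟩
    · push Not at hp
      choose q s hqs hlt using hp
      obtain ⟨k, hk, hsum⟩ := ih (fun p p' => c (Nat.pair p (q p)) (Nat.pair p' (q p')))
        (fun _ _ => hc _ _) (fun p t hpt => by
          classical
          have hinj : Function.Injective fun p' => Nat.pair p' (q p') :=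
            fun u v huv => (Nat.pair_eq_pair.1 huv).1
          have hinj' : Function.Injective (Nat.pair p) :=
            fun u v huv => (Nat.pair_eq_pair.1 huv).2
          have hdis : Disjoint (t.image fun p' => Nat.pair p' (q p')) ((s p).image (Nat.pair p)) := by
            rw [Finset.disjoint_left]
            intro u hu hu'
            obtain ⟨p', hp', rfl⟩ := Finset.mem_image.1 hu
            obtain ⟨r, hr, hrp⟩ := Finset.mem_image.1 hu'
            rw [Nat.pair_eq_pair] at hrp
            exact hpt (hrp.1 ▸ hp')
          have h1 := h (Nat.pair p (q p))
            ((t.image fun p' => Nat.pair p' (q p')) ∪ (s p).image (Nat.pair p)) (by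
              rw [Finset.mem_union, Finset.mem_image, Finset.mem_image]
              rintro (⟨p', hp', he⟩ | ⟨r, hr, he⟩)
              · exact hpt ((Nat.pair_eq_pair.1 he).1 ▸ hp')
              · exact hqs p ((Nat.pair_eq_pair.1 he).2 ▸ hr))
          rw [Finset.sum_union hdis, Finset.sum_image hinj.injOn,
            Finset.sum_image hinj'.injOn] at h1
          have h2 := hlt p
          push_cast at h1
          linarith)
      exact ⟨fun n => Nat.pair (k n) (q (k n)),
        fun u v huv => hk (Nat.pair_eq_pair.1 huv).1, hsum⟩

/-- Rosenthal's lemma: a nonnegative matrix with bounded row sums has an infinite submatrix with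
small sums of the entries off the diagonal in each row. -/
theorem exists_injective_sum_le {c : ℕ → ℕ → ℝ} (hc : ∀ n m, 0 ≤ c n m) {C : ℝ}
    (h : ∀ n (s : Finset ℕ), ∑ m ∈ s, c n m ≤ C) {ε : ℝ} (hε : 0 < ε) :
    ∃ k : ℕ → ℕ, Function.Injective k ∧
      ∀ n (s : Finset ℕ), n ∉ s → ∑ m ∈ s, c (k n) (k m) ≤ ε := by
  obtain ⟨N, hN⟩ := exists_nat_gt (C / ε)
  rw [div_lt_iff₀ hε] at hN
  exact exists_injective_sum_le_aux N c hc fun n s _ => (h n s).trans (by nlinarith)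

/-- The codes of the finite initial segments of a binary sequence. -/
def branch (ξ : ℕ → Bool) : Set ℕ :=
  range fun n => Encodable.encode ((List.range n).map ξ)

theorem infinite_branch (ξ : ℕ → Bool) : (branch ξ).Infinite := by
  refine infinite_range_of_injective fun m n hmn => ?_
  have h := congrArg List.length (Encodable.encode_injective hmn)
  simpa using h

/-- Branches that differ at `k` share no initial segments longer than `k`. -/
theorem finite_branch_inter {ξ ζ : ℕ → Bool} (h : ξ ≠ ζ) : (branch ξ ∩ branch ζ).Finite := by
  obtain ⟨k, hk⟩ := Function.ne_iff.1 h
  refine ((Set.finite_Iic k).image fun n => Encodable.encode ((List.range n).map ξ)).subset ?_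
  rintro _ ⟨⟨m, rfl⟩, ⟨n, hn⟩⟩
  refine ⟨m, ?_, rfl⟩
  have h1 := Encodable.encode_injective hn
  have h2 : n = m := by simpa using congrArg List.length h1
  subst h2
  rw [mem_Iic]
  by_contra! hlt
  have h3 := List.map_inj_left.1 h1 k (List.mem_range.2 hlt)
  exact hk h3.symm

theorem uncountable_binary : Uncountable (ℕ → Bool) := by
  rw [← Cardinal.aleph0_lt_mk_iff]
  simpa using Cardinal.cantor Cardinal.aleph0

theorem exists_notMem_iUnion_finset (X : ℕ → Finset (ℕ → Bool)) : ∃ ξ, ∀ n, ξ ∉ X n := by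
  have := uncountable_binary
  by_contra! h
  have h1 : (⋃ n, (X n : Set (ℕ → Bool))).Countable :=
    countable_iUnion fun n => (X n).countable_toSet
  have h2 : (univ : Set (ℕ → Bool)).Countable := h1.mono fun ξ _ => by
    obtain ⟨n, hn⟩ := h ξ
    exact mem_iUnion.2 ⟨n, hn⟩
  exact not_countable_univ h2

end Combinatorics

/-! ### Sums over disjoint families of clopen sets. -/

namespace StoneSpace

variable {A : Type*} [BooleanAlgebra A]

theorem sum_ind_eq {ι : Type*} (s : Finset ι) (a : ι → A)
    (h : (s : Set ι).PairwiseDisjoint a) : ∑ i ∈ s, ind (a i) = ind (s.sup a) := by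
  classical
  induction s using Finset.induction_on with
  | empty => simp [ind_bot]
  | insert i s hi ih =>
    rw [Finset.sum_insert hi, Finset.sup_insert, ih (h.subset (by simp)), ind_sup]
    rw [Finset.disjoint_sup_right]
    exact fun j hj => h (by simp) (by simp [hj]) (by rintro rfl; exact hi hj)

theorem sum_ind_apply_le_one {ι : Type*} (s : Finset ι) (a : ι → A)
    (h : (s : Set ι).PairwiseDisjoint a) (x : StoneSpace A) : ∑ i ∈ s, ind (a i) x ≤ 1 := by
  rw [← ContinuousMap.sum_apply, sum_ind_eq s a h]
  exact (le_abs_self _).trans (abs_ind_le_one _ _)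

theorem sum_abs_apply_ind_le {ι : Type*} (T : C(StoneSpace A, ℝ) →L[ℝ] C(StoneSpace A, ℝ))
    (s : Finset ι) (a : ι → A) (h : (s : Set ι).PairwiseDisjoint a) (x : StoneSpace A) :
    ∑ i ∈ s, |T (ind (a i)) x| ≤ ‖T‖ := by
  -- Testing `T` on the signed sum: disjointness keeps its norm at most `1`.
  let f : C(StoneSpace A, ℝ) := ∑ i ∈ s, (SignType.sign (T (ind (a i)) x) : ℝ) • ind (a i)
  have hf : ‖f‖ ≤ 1 := by
    refine (ContinuousMap.norm_le _ zero_le_one).2 fun z => ?_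
    rw [ContinuousMap.sum_apply]
    refine (norm_sum_le _ _).trans (le_trans (Finset.sum_le_sum fun i _ => ?_)
      (sum_ind_apply_le_one s a h z))
    rw [ContinuousMap.smul_apply, norm_smul, Real.norm_of_nonneg (ind_nonneg _ _)]
    refine mul_le_of_le_one_left (ind_nonneg _ _) ?_
    rcases SignType.sign (T (ind (a i)) x) with _ | _ | _ <;> simp
  have h1 : T f x = ∑ i ∈ s, |T (ind (a i)) x| := by
    rw [map_sum, ContinuousMap.sum_apply]
    refine Finset.sum_congr rfl fun i _ => ?_
    rw [map_smul, ContinuousMap.smul_apply, smul_eq_mul, sign_mul_self]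
  rw [← h1]
  exact (le_abs_self _).trans (((T f).norm_coe_le_norm x).trans ((T.le_opNorm f).trans
    (mul_le_of_le_one_right (norm_nonneg _) hf)))

end StoneSpace

/-! ### Submorphisms and the proof of the main theorem -/

theorem IsSubmorphism.disjoint {B A : Type*} [BooleanAlgebra B] [BooleanAlgebra A] {φ : B → A}
    (hφ : IsSubmorphism φ) {x y : B} (h : Disjoint x y) : Disjoint (φ x) (φ y) := by
  rw [disjoint_iff, ← hφ.map_inf, h.eq_bot, hφ.map_bot]

namespace StoneSpace

variable {A : Type*} [BooleanAlgebra A]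

/-- A submorphism respects only finite joins, so `φ τ` may exceed the `a m`, `m ∈ τ`; the excess is
carried by the tails. -/
theorem ind_eq_tail_add_sum {P : BooleanSubalgebra (Set ℕ)} (hfin : ∀ s : Set ℕ, s.Finite → s ∈ P)
    {φ : P → A} (hφ : IsSubmorphism φ) {a : ℕ → A}
    (hφa : ∀ n : ℕ, φ ⟨{n}, hfin {n} (finite_singleton n)⟩ = a n) (τ : P) (N : ℕ) :
    ind (φ τ) = ind (φ (τ \ ⟨Iio N, hfin _ (finite_Iio N)⟩)) +
      ∑ m ∈ Finset.range N, (τ : Set ℕ).indicator (fun m => ind (a m)) m := by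
  induction N with
  | zero =>
    have h : τ \ ⟨Iio 0, hfin _ (finite_Iio 0)⟩ = τ := by
      apply Subtype.ext
      rw [BooleanSubalgebra.val_sdiff]
      ext n
      simp
    rw [h]
    simp
  | succ N ih =>
    rw [ih, Finset.sum_range_succ]
    by_cases hN : N ∈ (τ : Set ℕ)
    · have h : τ \ ⟨Iio N, hfin _ (finite_Iio N)⟩ =
          τ \ ⟨Iio (N + 1), hfin _ (finite_Iio (N + 1))⟩ ⊔
            ⟨{N}, hfin {N} (finite_singleton N)⟩ := by
        apply Subtype.ext
        rw [BooleanSubalgebra.val_sup, BooleanSubalgebra.val_sdiff, BooleanSubalgebra.val_sdiff]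
        ext n
        simp only [sup_eq_union, mem_union, mem_sdiff, mem_Iio, mem_singleton_iff]
        constructor
        · rintro ⟨h1, h2⟩
          by_cases h3 : n = N
          · exact Or.inr h3
          · exact Or.inl ⟨h1, by omega⟩
        · rintro (⟨h1, h2⟩ | rfl)
          · exact ⟨h1, by omega⟩
          · exact ⟨hN, by omega⟩
      have hd : Disjoint (τ \ ⟨Iio (N + 1), hfin _ (finite_Iio (N + 1))⟩)
          ⟨{N}, hfin {N} (finite_singleton N)⟩ := by
        rw [disjoint_iff]
        apply Subtype.ext
        rw [BooleanSubalgebra.val_inf, BooleanSubalgebra.val_sdiff, BooleanSubalgebra.val_bot]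
        ext n
        simp only [inf_eq_inter, mem_inter_iff, mem_sdiff, mem_Iio, mem_singleton_iff,
          bot_eq_empty, mem_empty_iff_false, iff_false]
        omega
      rw [h, hφ.map_sup, ind_sup (hφ.disjoint hd), hφa, indicator_of_mem hN]
      abel
    · have h : τ \ ⟨Iio N, hfin _ (finite_Iio N)⟩ =
          τ \ ⟨Iio (N + 1), hfin _ (finite_Iio (N + 1))⟩ := by
        apply Subtype.ext
        rw [BooleanSubalgebra.val_sdiff, BooleanSubalgebra.val_sdiff]
        ext n
        simp only [mem_sdiff, mem_Iio]
        constructor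
        · rintro ⟨h1, h2⟩
          refine ⟨h1, fun h3 => hN ?_⟩
          obtain rfl : n = N := by omega
          exact h1
        · rintro ⟨h1, h2⟩
          exact ⟨h1, by omega⟩
      rw [h, indicator_of_notMem hN, add_zero]

theorem tendsto_apply_tail {P : BooleanSubalgebra (Set ℕ)} (hfin : ∀ s : Set ℕ, s.Finite → s ∈ P)
    {φ : P → A} (hφ : IsSubmorphism φ) {a : ℕ → A}
    (hφa : ∀ n : ℕ, φ ⟨{n}, hfin {n} (finite_singleton n)⟩ = a n)
    (T : C(StoneSpace A, ℝ) →L[ℝ] C(StoneSpace A, ℝ)) (τ : P) (y : StoneSpace A)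
    (hs : Summable fun m => T (ind (a m)) y) :
    Filter.Tendsto (fun N => T (ind (φ (τ \ ⟨Iio N, hfin _ (finite_Iio N)⟩))) y) Filter.atTop
      (nhds (T (ind (φ τ)) y - ∑' m, (τ : Set ℕ).indicator (fun m => T (ind (a m)) y) m)) := by
  have h1 := (hs.indicator (τ : Set ℕ)).hasSum.tendsto_sum_nat
  refine (h1.const_sub (T (ind (φ τ)) y)).congr fun N => ?_
  rw [sub_eq_iff_eq_add, ind_eq_tail_add_sum hfin hφ hφa τ N, map_add, ContinuousMap.add_apply,
    map_sum, ContinuousMap.sum_apply]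
  congr 1
  refine Finset.sum_congr rfl fun m _ => ?_
  by_cases hm : m ∈ (τ : Set ℕ) <;> simp [hm]

theorem summable_apply_ind (T : C(StoneSpace A, ℝ) →L[ℝ] C(StoneSpace A, ℝ)) {a : ℕ → A}
    (ha : Pairwise (Function.onFun Disjoint a)) (y : StoneSpace A) :
    Summable fun m => T (ind (a m)) y :=
  (summable_of_sum_le (fun _ => abs_nonneg _)
    fun s => sum_abs_apply_ind_le T s a (fun _ _ _ _ h => ha h) y).of_abs

/-- Each error is a limit of values of `T` on tails, and tails of finitely many almost disjoint sets
are eventually disjoint. -/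
theorem sum_abs_tail_le {P : BooleanSubalgebra (Set ℕ)} (hfin : ∀ s : Set ℕ, s.Finite → s ∈ P)
    {φ : P → A} (hφ : IsSubmorphism φ) {a : ℕ → A} (ha : Pairwise (Function.onFun Disjoint a))
    (hφa : ∀ n : ℕ, φ ⟨{n}, hfin {n} (finite_singleton n)⟩ = a n)
    (T : C(StoneSpace A, ℝ) →L[ℝ] C(StoneSpace A, ℝ)) {ι : Type*} (X : Finset ι) (τ : ι → P)
    (hτ : ∀ i ∈ X, ∀ j ∈ X, i ≠ j → ((τ i : Set ℕ) ∩ τ j).Finite) (y : StoneSpace A) :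
    ∑ i ∈ X, |T (ind (φ (τ i))) y -
      ∑' m, (τ i : Set ℕ).indicator (fun m => T (ind (a m)) y) m| ≤ ‖T‖ := by
  have hlim := tendsto_finsetSum X fun i _ =>
    (tendsto_apply_tail hfin hφ hφa T (τ i) y (summable_apply_ind T ha y)).abs
  refine le_of_tendsto hlim ?_
  have hev : ∀ᶠ N in Filter.atTop, ∀ i ∈ X, ∀ j ∈ X, i ≠ j →
      Disjoint (φ (τ i \ ⟨Iio N, hfin _ (finite_Iio N)⟩))
        (φ (τ j \ ⟨Iio N, hfin _ (finite_Iio N)⟩)) := by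
    rw [Filter.eventually_all_finset]
    intro i hi
    rw [Filter.eventually_all_finset]
    intro j hj
    by_cases hij : i = j
    · exact Filter.Eventually.of_forall fun _ h => absurd hij h
    obtain ⟨N₀, hN₀⟩ := (hτ i hi j hj hij).bddAbove
    filter_upwards [Filter.eventually_gt_atTop N₀] with N hN _
    refine hφ.disjoint ?_
    rw [disjoint_iff]
    apply Subtype.ext
    rw [BooleanSubalgebra.val_inf, BooleanSubalgebra.val_sdiff, BooleanSubalgebra.val_sdiff,
      BooleanSubalgebra.val_bot]
    ext n
    simp only [inf_eq_inter, mem_inter_iff, mem_sdiff, mem_Iio, bot_eq_empty,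
      mem_empty_iff_false, iff_false]
    rintro ⟨⟨h1, h2⟩, h3, -⟩
    have := hN₀ ⟨h1, h3⟩
    omega
  filter_upwards [hev] with N hN
  exact sum_abs_apply_ind_le T X _ (fun i hi j hj hij => hN i hi j hj hij) y

/-- If the sums of the `|r (t i)|` over admissible choices `t` are bounded on a basic set, then on a
smaller nonempty basic set all `r t` are small that are admissible for `i` outside of a finite
set. -/
theorem exists_le_forall_abs_le {ι κ : Type*} {b : A} (hb : b ≠ ⊥) (r : κ → StoneSpace A → ℝ)
    (hr : ∀ t, Continuous (r t)) (Adm : ι → κ → Prop) {C ε : ℝ} (hε : 0 < ε)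
    (hsum : ∀ (X : Finset ι) (t : ι → κ), (∀ i ∈ X, Adm i (t i)) → ∀ y ∈ basicSet b,
      ∑ i ∈ X, |r (t i) y| ≤ C) :
    ∃ c ≤ b, c ≠ ⊥ ∧ ∃ X : Finset ι, ∀ i ∉ X, ∀ t, Adm i t → ∀ y ∈ basicSet c, |r t y| ≤ ε := by
  classical
  by_contra! hcon
  -- Each failure adds an index whose `|r|` exceeds `ε` on a smaller clopen set; more than `C / ε`
  -- such indices break the bound.
  have key : ∀ n : ℕ, ∃ c ≤ b, c ≠ ⊥ ∧ ∃ X : Finset ι, X.card = n ∧ ∀ i ∈ X, ∃ t, Adm i t ∧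
      ∀ y ∈ basicSet c, ε < |r t y| := by
    intro n
    induction n with
    | zero => exact ⟨b, le_rfl, hb, ∅, by simp⟩
    | succ n ih =>
      obtain ⟨c, hcb, hc, X, hX, h⟩ := ih
      obtain ⟨i, hi, t, ht, y, hy, hlt⟩ := hcon c hcb hc X
      obtain ⟨c', hyc', hc'⟩ := exists_mem_basicSet_subset ((isClopen_basicSet c).isOpen.inter
        (isOpen_lt continuous_const (hr t).abs)) (x := y) ⟨hy, hlt⟩
      have hle : c' ≤ c := basicSet_subset_iff.1 fun z hz => (hc' hz).1
      refine ⟨c', hle.trans hcb, ne_bot_of_mem_basicSet hyc', insert i X, ?_, fun j hj => ?_⟩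
      · rw [Finset.card_insert_of_notMem hi, hX]
      · rcases Finset.mem_insert.1 hj with rfl | hj
        · exact ⟨t, ht, fun z hz => (hc' hz).2⟩
        · obtain ⟨s, hs, h2⟩ := h j hj
          exact ⟨s, hs, fun z hz => h2 z (basicSet_mono hle hz)⟩
  obtain ⟨n, hn⟩ := exists_nat_gt (C / ε)
  obtain ⟨c, hcb, hc, X, hX, h⟩ := key n
  obtain ⟨y, hy⟩ := nonempty_basicSet hc
  have hκ : Nonempty κ := by
    obtain ⟨i, -, t, -⟩ := hcon b le_rfl hb ∅
    exact ⟨t⟩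
  choose! t ht hlt using h
  have h1 := hsum X t ht y (basicSet_mono hcb hy)
  have h2 : (X.card : ℝ) * ε ≤ ∑ i ∈ X, |r (t i) y| := by
    rw [← nsmul_eq_mul]
    exact Finset.card_nsmul_le_sum _ _ _ fun i hi => (hlt i hi y hy).le
  rw [div_lt_iff₀ hε] at hn
  rw [hX] at h2
  linarith

theorem abs_tsum_sub_le {α : ℕ → ℝ} (hα : Summable α) {θ : ℝ} {n : ℕ}
    (h : ∀ s : Finset ℕ, n ∉ s → ∑ m ∈ s, |α m| ≤ θ) : |∑' m, α m - α n| ≤ θ := by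
  refine le_of_tendsto (hα.hasSum.sub_const (α n)).abs ?_
  filter_upwards [Filter.eventually_ge_atTop {n}] with s hs
  classical
  rw [← Finset.add_sum_erase s α (Finset.singleton_subset_iff.1 hs), add_sub_cancel_left]
  exact (Finset.abs_sum_le_sum_abs _ _).trans (h _ (Finset.notMem_erase n s))

/-- In an almost `P`-space, countably many continuous functions are simultaneously constant on a
nonempty basic set, that can be chosen outside of the given clopen sets not containing `x`. -/
theorem exists_basicSet_forall_eq (hA : IsAlmostPAlgebra A) (F : ℕ → C(StoneSpace A, ℝ))
    (a : ℕ → A) (x : StoneSpace A) (hx : ∀ m, x ∉ basicSet (a m)) :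
    ∃ b : A, b ≠ ⊥ ∧ ∀ y ∈ basicSet b, ∀ m, F m y = F m x ∧ y ∉ basicSet (a m) := by
  have hG : IsGδ (⋂ m, (F m ⁻¹' {F m x}) ∩ (basicSet (a m))ᶜ) :=
    IsGδ.iInter fun m => ((IsGδ.singleton _).preimage (F m).continuous).inter
      (isClopen_basicSet (a m)).compl.isOpen.isGδ
  obtain ⟨y, hy⟩ := hA _ hG ⟨x, mem_iInter.2 fun m => ⟨rfl, hx m⟩⟩
  obtain ⟨b, hyb, hb⟩ := exists_mem_basicSet_subset isOpen_interior hy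
  exact ⟨b, ne_bot_of_mem_basicSet hyb, fun z hz m => mem_iInter.1 (interior_subset (hb hz)) m⟩

end StoneSpace

/-! ### The contradiction with inseparability. -/

namespace StoneSpace

theorem negligibleOffSupport_of_submorphisms {A : Type*} [BooleanAlgebra A]
    (hA : IsAlmostPAlgebra A)
    (h : ∀ a : ℕ → A, (∀ n, a n ≠ ⊥) → (∀ m n, m ≠ n → a m ⊓ a n = ⊥) →
      ∃ (P : BooleanSubalgebra (Set ℕ)) (hfin : ∀ s : Set ℕ, s.Finite → s ∈ P) (φ : P → A),
        IsSubmorphism φ ∧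
        (∀ n : ℕ, φ ⟨{n}, hfin {n} (Set.finite_singleton n)⟩ = a n) ∧
        ∀ (σ : Set ℕ) (b : ℕ → A), σ.Infinite → (∀ n ∈ σ, b n ≠ ⊥) →
          (∀ m ∈ σ, ∀ n ∈ σ, m ≠ n → b m ⊓ b n = ⊥) →
          AreOrthogonal (b '' σ) (Set.range a) →
          ∃ τ ⊆ σ, τ ∈ P ∧ ¬ AreSeparated (b '' τ) (b '' (σ \ τ)))
    (T : C(StoneSpace A, ℝ) →L[ℝ] C(StoneSpace A, ℝ)) : NegligibleOffSupport T := by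
  intro ε hε a₀ x₀ ha₀ hx₀ hbig₀
  -- The added term `ind (a₀ m) (x₀ n)`, bounded by `1/2` off the diagonal, keeps every `x n`
  -- outside every `a m`.
  obtain ⟨k, hk, hsum⟩ := exists_injective_sum_le
    (c := fun n m => |T (ind (a₀ m)) (x₀ n)| + ind (a₀ m) (x₀ n))
    (fun n m => add_nonneg (abs_nonneg _) (ind_nonneg _ _)) (C := ‖T‖ + 1) (fun n s => by
      have hs : (s : Set ℕ).PairwiseDisjoint a₀ := fun _ _ _ _ hij => ha₀ hij
      rw [Finset.sum_add_distrib]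
      exact add_le_add (sum_abs_apply_ind_le T s a₀ hs _) (sum_ind_apply_le_one s a₀ hs _))
    (show 0 < min (ε / 8) (1 / 2) by positivity)
  let a : ℕ → A := fun n => a₀ (k n)
  let x : ℕ → StoneSpace A := fun n => x₀ (k n)
  have ha : Pairwise (Function.onFun Disjoint a) := fun m n hmn => ha₀ (hk.ne hmn)
  have hbig : ∀ n, ε < |T (ind (a n)) (x n)| := fun n => hbig₀ (k n)
  have hx : ∀ n m, x n ∉ basicSet (a m) := by
    intro n m hnm
    by_cases hne : n = m
    · subst hne
      exact hx₀ _ hnm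
    · have h1 := hsum n {m} (by simpa using hne)
      rw [Finset.sum_singleton] at h1
      have h2 : ind (a m) (x n) = 1 := ind_apply_of_mem hnm
      have h3 := abs_nonneg (T (ind (a₀ (k m))) (x₀ (k n)))
      have h4 := min_le_right (ε / 8) (1 / 2)
      change |T (ind (a m)) (x n)| + ind (a m) (x n) ≤ _ at h1
      change 0 ≤ |T (ind (a m)) (x n)| at h3
      linarith
  have hoff : ∀ n (s : Finset ℕ), n ∉ s → ∑ m ∈ s, |T (ind (a m)) (x n)| ≤ ε / 8 := fun n s hs =>
    (Finset.sum_le_sum fun m _ => le_add_of_nonneg_right (ind_nonneg _ _)).trans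
      ((hsum n s hs).trans (min_le_left _ _))
  choose b hb hbx using fun n =>
    exists_basicSet_forall_eq hA (fun m => T (ind (a m))) a (x n) (hx n)
  have hane : ∀ n, a n ≠ ⊥ := by
    intro n hn
    have h1 := hbig n
    rw [hn, ind_bot, map_zero, ContinuousMap.zero_apply, abs_zero] at h1
    linarith
  obtain ⟨P, hfin, φ, hφ, hφa, hsep⟩ := h a hane fun m n hmn => (ha hmn).eq_bot
  let S : ℕ → P → ℝ := fun n t => ∑' m, (t : Set ℕ).indicator (fun m => T (ind (a m)) (x n)) m
  have hS : ∀ n t, |S n t - (t : Set ℕ).indicator (fun m => T (ind (a m)) (x n)) n| ≤ ε / 8 := by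
    intro n t
    refine abs_tsum_sub_le ((summable_apply_ind T ha (x n)).indicator _) fun s hs => ?_
    refine (Finset.sum_le_sum fun m _ => ?_).trans (hoff n s hs)
    rw [← Real.norm_eq_abs, ← Real.norm_eq_abs]
    exact norm_indicator_le_norm_self _ _
  -- All subsets of a branch are admissible at once, since the `τ` given by condition 3 is known
  -- only after the branch is fixed. Constancy of `T 1_{a m}` on `b n` turns the errors into
  -- continuous functions there.
  choose c hcb hc X hX using fun n => exists_le_forall_abs_le (hb n)
    (fun t y => T (ind (φ t)) y - S n t) (fun t => by fun_prop)
    (fun (ξ : ℕ → Bool) (t : P) => (t : Set ℕ) ⊆ branch ξ) (show 0 < ε / 8 by positivity)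
    (C := ‖T‖) (fun X t ht y hy => by
      have h1 : (fun m => T (ind (a m)) (x n)) = fun m => T (ind (a m)) y :=
        funext fun m => (hbx n y hy m).1.symm
      simp only [S, h1]
      exact sum_abs_tail_le hfin hφ ha hφa T X t (fun i hi j hj hij =>
        (finite_branch_inter hij).subset (inter_subset_inter (ht i hi) (ht j hj))) y)
  obtain ⟨ξ, hξ⟩ := exists_notMem_iUnion_finset X
  obtain ⟨τ, hτ, hτP, hnot⟩ := hsep (branch ξ) c (infinite_branch ξ) (fun n _ => hc n)
    -- The sets `c m` and `c n` are disjoint because `|T 1_{a n}|` is at most `ε / 8` on the first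
    -- and above `ε` on the second.
    (fun m _ n _ hmn => by
      refine (disjoint_of_basicSet fun y hym hyn => ?_).eq_bot
      have h1 := (hbx m y (basicSet_mono (hcb m) hym) n).1
      have h2 := (hbx n y (basicSet_mono (hcb n) hyn) n).1
      have h3 := hoff m {n} (by simpa using hmn)
      rw [Finset.sum_singleton, ← h1, h2] at h3
      linarith [hbig n])
    (by
      rintro _ ⟨n, -, rfl⟩ _ ⟨m, rfl⟩
      exact (disjoint_of_basicSet fun y hy =>
        (hbx n y (basicSet_mono (hcb n) hy) m).2).eq_bot)
  let f := T (ind (φ ⟨τ, hτP⟩))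
  have hf : ∀ n, ∀ y ∈ basicSet (c n), |f y - S n ⟨τ, hτP⟩| ≤ ε / 8 := fun n y hy =>
    hX n ξ (hξ n) ⟨τ, hτP⟩ hτ y hy
  -- Two errors of `ε / 8` separate `f` from `T 1_{a n} (x n)` on `c n`, and from `0` when `n ∉ τ`;
  -- the gap between `3ε/4` and `ε/4` leaves room for a clopen set.
  have hin : ∀ n ∈ τ, ∀ y ∈ basicSet (c n), 3 * ε / 4 ≤ |f y| := by
    intro n hn y hy
    have h1 := hS n ⟨τ, hτP⟩
    rw [indicator_of_mem hn] at h1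
    have h2 := hf n y hy
    have h3 := hbig n
    have h4 := abs_sub_abs_le_abs_sub (T (ind (a n)) (x n)) (f y)
    have h5 := abs_sub_le (T (ind (a n)) (x n)) (S n ⟨τ, hτP⟩) (f y)
    rw [abs_sub_comm (T (ind (a n)) (x n)) (S n _), abs_sub_comm (S n _) (f y)] at h5
    linarith
  have hout : ∀ n ∉ τ, ∀ y ∈ basicSet (c n), |f y| ≤ ε / 4 := by
    intro n hn y hy
    have h1 := hS n ⟨τ, hτP⟩
    rw [indicator_of_notMem hn, sub_zero] at h1
    have h2 := hf n y hy
    have h4 := abs_sub_abs_le_abs_sub (f y) (S n ⟨τ, hτP⟩)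
    linarith
  obtain ⟨e, he1, he2⟩ := exists_basicSet_between (Z := {y | 3 * ε / 4 ≤ |f y|})
    (U := {y | ε / 4 < |f y|}) (isClosed_le continuous_const f.continuous.abs)
    (isOpen_lt continuous_const f.continuous.abs) (fun y hy => by
      have hy : 3 * ε / 4 ≤ |f y| := hy
      change ε / 4 < |f y|
      linarith)
  refine hnot ⟨e, ?_, ?_⟩
  · rintro _ ⟨n, hn, rfl⟩
    exact basicSet_subset_iff.1 fun y hy => he1 (hin n hn y hy)
  · rintro _ ⟨n, hn, rfl⟩
    refine (disjoint_of_basicSet fun y hy hye => ?_).eq_bot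
    have h1 : ε / 4 < |f y| := he2 hye
    exact absurd (hout n hn.2 y hy) (not_le.2 h1)

end StoneSpace

theorem mainTheorem2 {A : Type*} [BooleanAlgebra A] (hA : IsAlmostPAlgebra A)
    (h : ∀ a : ℕ → A, (∀ n, a n ≠ ⊥) → (∀ m n, m ≠ n → a m ⊓ a n = ⊥) →
      ∃ (P : BooleanSubalgebra (Set ℕ)) (hfin : ∀ s : Set ℕ, s.Finite → s ∈ P) (φ : P → A),
        IsSubmorphism φ ∧
        (∀ n : ℕ, φ ⟨{n}, hfin {n} (Set.finite_singleton n)⟩ = a n) ∧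
        ∀ (σ : Set ℕ) (b : ℕ → A), σ.Infinite → (∀ n ∈ σ, b n ≠ ⊥) →
          (∀ m ∈ σ, ∀ n ∈ σ, m ≠ n → b m ⊓ b n = ⊥) →
          AreOrthogonal (b '' σ) (Set.range a) →
          ∃ τ ⊆ σ, τ ∈ P ∧ ¬ AreSeparated (b '' τ) (b '' (σ \ τ)))
    (T : C(StoneSpace A, ℝ) →L[ℝ] C(StoneSpace A, ℝ)) :
    IsWeakMultiplier T := by
  exact (StoneSpace.negligibleOffSupport_of_submorphisms hA h T).isWeakMultiplier
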